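/- Let $\Omega\subset\mathbb R^3$ be an open set. Let $H^1_0(\Omega)^3$ be the completion of the space of smooth vector fields $\boldsymbol v:\Omega\to\mathbb C^3$ with compact support in $\Omega$ with respect to $|\boldsymbol v|_{1,\Omega}=\|\nabla\boldsymbol v\|_{L^2(\Omega)}$ (for bounded $\Omega$ this is the usual Sobolev space), and let $H^{-1}(\Omega)^3$ be its dual space. For $\sigma\in\mathbb C$ let $L_\sigma=\sigma\Delta-\nabla\operatorname{div}:H^1_0(\Omega)^3\to H^{-1}(\Omega)^3$ be the bounded operator defined by $$\langle L_\sigma\boldsymbol u,\boldsymbol v\rangle=-\sigma\int_\Omega\nabla\boldsymbol u:\nabla\boldsymbol v\,dx+\int_\Omega\operatorname{div}\boldsymbol u\,\operatorname{div}\boldsymbol v\,dx ,\qquad \boldsymbol u,\boldsymbol v\in H^1_0(\Omega)^3 .$$ The essential spectrum of the Cosserat problem in $\Omega$ is the set of all $\sigma\in\mathbb C$ for which $L_\sigma$ is not a Fredholm operator. **Theorem 4.1.** Let $\omega\in(0,2\pi)$, and suppose that the boundary of $\Omega$ contains a piece of a straight edge of opening $\omega$ in the sense that, for some $R>0$, $$\Big\{x\in\Omega:\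 \sqrt{x_1^2+x_2^2}\le 2R,\ |x_3|\le 2R\Big\}=\Big\{x\in\mathbb R^3:\ \sqrt{x_1^2+x_2^2}\le 2R,\ |x_3|\le 2R,\ x_1+ix_2\ne0,\ |\arg(x_1+ix_2)|<\tfrac\omega2\Big\},$$ where $\arg$ takes values in $(-\pi,\pi]$. Then the interval $$\Big[\tfrac12-\tfrac{|\sin\omega|}{2\omega},\ \tfrac12+\tfrac{|\sin\omega|}{2\omega}\Big]$$ is contained in the essential spectrum of the Cosserat problem in $\Omega$. -/

import Mathlib

open MeasureTheory TopologicalSpace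
open scoped Distributions ENNReal

namespace Cosserat

noncomputable section

/-- Three-dimensional Euclidean space. -/
abbrev R3 : Type := EuclideanSpace ℝ (Fin 3)

/-- Values of complex vector fields. -/
abbrev C3 : Type := EuclideanSpace ℂ (Fin 3)

/-- Values of gradients of complex vector fields, with the Frobenius norm. The entry `(k, j)` of
the gradient of `v` is the partial derivative of the component `v k` in the direction `j`. -/
abbrev C33 : Type := EuclideanSpace ℂ (Fin 3 × Fin 3)

/-- The classical gradient (Jacobian matrix) of a vector field. -/
def jacobian (v : R3 → C3) (x : R3) : C33 :=
  WithLp.toLp 2 fun p => fderiv ℝ v x (EuclideanSpace.single p.2 1) p.1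

/-- The space `L²(Ω)` of square integrable matrix fields. -/
abbrev L2Mat (Ω : Opens R3) : Type := Lp C33 2 (volume.restrict (Ω : Set R3))

theorem memLp_jacobian (Ω : Opens R3) (v : 𝓓(Ω, C3)) :
    MemLp (jacobian v) 2 (volume.restrict (Ω : Set R3)) := by
  have hc : Continuous (fderiv ℝ v) := v.contDiff.continuous_fderiv (by simp)
  refine Continuous.memLp_of_hasCompactSupport ?_ ?_
  · unfold jacobian
    fun_prop
  · refine (v.hasCompactSupport.fderiv ℝ).mono fun x hx => ?_
    contrapose! hx
    simp only [Function.mem_support, not_not] at hx ⊢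
    ext p
    simp [jacobian, hx]

/-- The smooth complex vector fields with compact support in `Ω`, as a type of their own: it will
carry the `H¹` seminorm and not the usual topology of the space of test functions. -/
def TestField (Ω : Opens R3) : Type := 𝓓(Ω, C3)

instance (Ω : Opens R3) : AddCommGroup (TestField Ω) := inferInstanceAs (AddCommGroup 𝓓(Ω, C3))

instance (Ω : Opens R3) : Module ℂ (TestField Ω) := inferInstanceAs (Module ℂ 𝓓(Ω, C3))

instance (Ω : Opens R3) : CoeFun (TestField Ω) (fun _ => R3 → C3) :=
  ⟨fun v => TestFunction.toFun v⟩

/-- The gradient of a test field, as an element of `L²(Ω)`. -/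
def testGrad (Ω : Opens R3) : TestField Ω →ₗ[ℂ] L2Mat Ω where
  toFun v := (memLp_jacobian Ω v).toLp (jacobian v)
  map_add' u v := by
    rw [← MemLp.toLp_add]
    congr 1
    funext x
    have hu : DifferentiableAt ℝ (u : R3 → C3) x :=
      (TestFunction.contDiff u).differentiable (by simp) x
    have hv : DifferentiableAt ℝ (v : R3 → C3) x :=
      (TestFunction.contDiff v).differentiable (by simp) x
    have h : ((u + v : TestField Ω) : R3 → C3) = (u : R3 → C3) + v := rfl
    ext p
    change fderiv ℝ ((u + v : TestField Ω) : R3 → C3) x _ _ = _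
    rw [h, fderiv_add hu hv]
    rfl
  map_smul' c v := by
    rw [RingHom.id_apply, ← MemLp.toLp_const_smul]
    congr 1
    funext x
    have hv : DifferentiableAt ℝ (v : R3 → C3) x :=
      (TestFunction.contDiff v).differentiable (by simp) x
    have h : ((c • v : TestField Ω) : R3 → C3) = c • (v : R3 → C3) := rfl
    ext p
    change fderiv ℝ ((c • v : TestField Ω) : R3 → C3) x _ _ = _
    rw [h, fderiv_const_smul hv]
    rfl

/-- The `H¹` seminorm `|v|₁ = ‖grad v‖` on test fields. -/
instance (Ω : Opens R3) : SeminormedAddCommGroup (TestField Ω) :=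
  SeminormedAddCommGroup.induced _ _ (testGrad Ω)

instance (Ω : Opens R3) : NormedSpace ℂ (TestField Ω) :=
  NormedSpace.induced ℂ _ _ (testGrad Ω)

/-- The Sobolev space `H¹₀(Ω)³`: the completion of the space of smooth vector fields with compact
support in `Ω` with respect to the `H¹` seminorm `|v|₁ = ‖grad v‖`. -/
abbrev H10 (Ω : Opens R3) : Type := UniformSpace.Completion (TestField Ω)

/-- `H⁻¹(Ω)³`, the dual of `H¹₀(Ω)³` with its dual norm. -/
abbrev Hm1 (Ω : Opens R3) : Type := StrongDual ℂ (H10 Ω)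

/-- The gradient on test fields, which by the choice of the seminorm is an isometry. -/
def testGradL (Ω : Opens R3) : TestField Ω →L[ℂ] L2Mat Ω :=
  (testGrad Ω).mkContinuous 1 fun v => by rw [one_mul]; exact le_rfl

/-- The (weak) gradient `H¹₀(Ω)³ → L²(Ω)`, the continuous extension of the gradient of test
fields. -/
def grad (Ω : Opens R3) : H10 Ω →L[ℂ] L2Mat Ω :=
  (testGradL Ω).extend UniformSpace.Completion.toComplL

theorem grad_coe (Ω : Opens R3) (v : TestField Ω) : grad Ω (v : H10 Ω) = testGrad Ω v :=
  (testGradL Ω).extend_eq UniformSpace.Completion.denseRange_coe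
    (UniformSpace.Completion.isUniformInducing_coe _) v

/-- The bilinear form `A : B = ∑ A k j * B k j` on matrices. -/
def dotForm : C33 →L[ℂ] C33 →L[ℂ] ℂ :=
  ∑ p : Fin 3 × Fin 3,
    (ContinuousLinearMap.mul ℂ ℂ).bilinearComp (EuclideanSpace.proj p) (EuclideanSpace.proj p)

/-- The trace of a matrix; the divergence of a field is the trace of its gradient. -/
def tr : C33 →L[ℂ] ℂ := ∑ k : Fin 3, EuclideanSpace.proj (k, k)

/-- The bilinear form `tr A * tr B` on matrices. -/
def traceForm : C33 →L[ℂ] C33 →L[ℂ] ℂ := (ContinuousLinearMap.mul ℂ ℂ).bilinearComp tr tr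

/-- The operator `L_σ = σ Δ - ∇ div : H¹₀(Ω)³ → H⁻¹(Ω)³`, given by its variational formulation
`⟨L_σ u, v⟩ = -σ ∫ grad u : grad v + ∫ div u * div v`. -/
def L (Ω : Opens R3) (σ : ℂ) : H10 Ω →L[ℂ] Hm1 Ω :=
  (-σ • dotForm.lpPairing (volume.restrict (Ω : Set R3)) 2 2
    + traceForm.lpPairing (volume.restrict (Ω : Set R3)) 2 2).bilinearComp (grad Ω) (grad Ω)

theorem L_apply (Ω : Opens R3) (σ : ℂ) (u v : H10 Ω) :
    L Ω σ u v =
      -σ * (∫ x in (Ω : Set R3), ∑ k, ∑ j, grad Ω u x (k, j) * grad Ω v x (k, j))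
        + ∫ x in (Ω : Set R3), (∑ k, grad Ω u x (k, k)) * (∑ k, grad Ω v x (k, k)) := by
  simp [L, dotForm, traceForm, tr, ContinuousLinearMap.lpPairing_eq_integral,
    ContinuousLinearMap.bilinearComp_apply, Fintype.sum_prod_type, Finset.sum_mul_sum]
  exact integral_congr_ae (Filter.Eventually.of_forall fun x => Finset.sum_comm)

/-- The essential spectrum of the Cosserat problem in `Ω`: the set of all complex `σ` for which
`L_σ` is not a Fredholm operator. -/
def essentialSpectrum (Ω : Opens R3) : Set ℂ := {σ | ¬ (L Ω σ).IsFredholm}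

/-- The solid cylinder of radius `ρ` about the third coordinate axis, bounded by the
planes `x₃ = ± ρ`. -/
def cylinder (ρ : ℝ) : Set R3 := {x | √(x 0 ^ 2 + x 1 ^ 2) ≤ ρ ∧ |x 2| ≤ ρ}

/-- The open wedge of opening `ω` whose edge is the third coordinate axis. The argument of `0` is
undefined, so that the axis is not part of the wedge. -/
def wedge (ω : ℝ) : Set R3 :=
  {x | (⟨x 0, x 1⟩ : ℂ) ≠ 0 ∧ |Complex.arg ⟨x 0, x 1⟩| < ω / 2}

/-- The boundary of `Ω` contains a piece of a straight edge of opening `ω`. -/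
def HasStraightEdge (Ω : Opens R3) (ω : ℝ) : Prop :=
  ∃ R : ℝ, 0 < R ∧ (Ω : Set R3) ∩ cylinder (2 * R) = cylinder (2 * R) ∩ wedge ω

end

end Cosserat

/-! Near the edge the problem is invariant under translations along the edge and, in the limit,
under dilations. `L Ω σ` fails to be Fredholm when the plane wedge problem has a solution r^{iξ}
φ(θ) with real ξ. Such a solution just misses finite energy, so cutting it off slowly in log r gives
approximate null fields living in shells ever closer to the edge.

Write u± = u₁ ± i u₂ and s = 2σ - 1. The plane equations say that -s ∂_z u₊ + ∂_z̄ u₋ is holomorphic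
and -s ∂_z̄ u₋ + ∂_z u₊ antiholomorphic. The ansatz u₊ = r^{iξ} φ(θ), u₋ = κ r^{iξ} φ(-θ) with κ =
±1 merges them into one equation, solved by combining z^{iξ}, z̄^{iξ} and z z̄^{iξ-1}. The
conditions φ(±ω/2) = 0 then reduce to s sinh(ωξ) = -κ ξ sin ω. Since sinh(ωξ)/ξ starts from ω at 0
and is unbounded, a suitable sign κ gives a root ξ > 0 whenever 0 < |s| < |sin ω|/ω
(`exists_characteristic`). For sin ω ≠ 0 the remaining values of s follow by continuity in σ
(`HasQuasimodes.of_approx`); for sin ω = 0 only s = 0 occurs, and every ξ is a root.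

The fields are χ(x₃) b(log r) h(θ), with b(t) = N^{-1/2} g(t/N + 2) e^{iξt}. In t = log r the energy
is dilation invariant (`integral_wpol_sq`), so differentiating g costs 1/N, while an axial
derivative gains r ≤ e^{-N}. The third component of the test field meets only axial derivatives
(`L_apply_complex`). Angular cutoffs are harmless because φ vanishes at the faces
(`exists_angular`). `exists_field_estimate` collects these errors; fields in disjoint shells have
orthogonal gradients, and `not_isFredholm_of_separated` concludes. -/

namespace Cosserat

open scoped ContDiff
open Set

/-! ### Smooth product functions in cylindrical coordinates -/

/-- The first two coordinates of a point of space, as a complex number. -/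
noncomputable def planar : R3 →L[ℝ] ℂ :=
  Complex.ofRealCLM ∘L EuclideanSpace.proj (0 : Fin 3)
    + (Complex.I • Complex.ofRealCLM) ∘L EuclideanSpace.proj (1 : Fin 3)

theorem planar_apply (x : R3) : planar x = ⟨x 0, x 1⟩ := by
  apply Complex.ext <;> simp [planar]

/-- The function `χ(x₃) b(log r) h(θ)` in cylindrical coordinates. -/
noncomputable def pol (χ b h : ℝ → ℂ) (x : R3) : ℂ :=
  χ (x 2) * b (Real.log ‖planar x‖) * h (Complex.arg (planar x))

/-- The conditions under which `pol χ b h` is a test function supported away from the half plane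
`θ = π`. -/
structure Cutoff (χ b h : ℝ → ℂ) : Prop where
  smooth_axial : ContDiff ℝ ∞ χ
  compact_axial : HasCompactSupport χ
  smooth_radial : ContDiff ℝ ∞ b
  compact_radial : HasCompactSupport b
  neg_radial : tsupport b ⊆ Iio 0
  smooth_angular : ContDiff ℝ ∞ h
  compact_angular : HasCompactSupport h
  angular_subset : tsupport h ⊆ Ioo (-Real.pi) Real.pi

/-- The point with given height, logarithm of the radius, and angle. -/
noncomputable def cylPoint (q : ℝ × ℝ × ℝ) : R3 :=
  !₂[Real.exp q.2.1 * Real.cos q.2.2, Real.exp q.2.1 * Real.sin q.2.2, q.1]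

theorem continuous_cylPoint : Continuous cylPoint := by
  refine (PiLp.continuous_toLp 2 _).comp (continuous_pi fun i => ?_)
  fin_cases i <;> simp <;> fun_prop

theorem planar_cylPoint (q : ℝ × ℝ × ℝ) :
    planar (cylPoint q) = Real.exp q.2.1 * (Real.cos q.2.2 + Real.sin q.2.2 * Complex.I) := by
  rw [planar_apply]
  apply Complex.ext <;>
    simp [cylPoint, -Complex.ofReal_cos, -Complex.ofReal_sin, -Complex.ofReal_exp]

theorem cylPoint_eq {x : R3} (hx : planar x ≠ 0) :
    cylPoint (x 2, Real.log ‖planar x‖, Complex.arg (planar x)) = x := by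
  have h3 : Real.exp (Real.log ‖planar x‖) = ‖planar x‖ := Real.exp_log (by positivity)
  ext i
  fin_cases i
  · change Real.exp (Real.log ‖planar x‖) * Real.cos _ = x 0
    rw [h3, Complex.norm_mul_cos_arg, planar_apply]
  · change Real.exp (Real.log ‖planar x‖) * Real.sin _ = x 1
    rw [h3, Complex.norm_mul_sin_arg, planar_apply]
  · simp [cylPoint]

theorem log_norm_planar_cylPoint (q : ℝ × ℝ × ℝ) :
    Real.log ‖planar (cylPoint q)‖ = q.2.1 := by
  rw [planar_cylPoint, Complex.ofReal_cos, Complex.ofReal_sin, ← Complex.exp_mul_I, norm_mul,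
    Complex.norm_exp_ofReal_mul_I, mul_one, Complex.norm_real, Real.norm_eq_abs, abs_of_pos (Real.exp_pos _),
    Real.log_exp]

theorem arg_planar_cylPoint (q : ℝ × ℝ × ℝ) (hq : q.2.2 ∈ Ioc (-Real.pi) Real.pi) :
    Complex.arg (planar (cylPoint q)) = q.2.2 := by
  rw [planar_cylPoint, Complex.ofReal_cos, Complex.ofReal_sin]
  exact Complex.arg_mul_cos_add_sin_mul_I (Real.exp_pos _) hq

theorem mem_slitPlane_of_arg {z : ℂ} (h0 : z ≠ 0) (h : Complex.arg z < Real.pi) :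
    z ∈ Complex.slitPlane :=
  Complex.mem_slitPlane_iff_arg.2 ⟨h.ne, h0⟩

namespace Cutoff

variable {χ b h : ℝ → ℂ}

/-- A compact set containing the support of `pol χ b h`. -/
def carrier (χ b h : ℝ → ℂ) : Set R3 := cylPoint '' (tsupport χ ×ˢ tsupport b ×ˢ tsupport h)

theorem isCompact_carrier (H : Cutoff χ b h) : IsCompact (carrier χ b h) :=
  (H.compact_axial.isCompact.prod
    (H.compact_radial.isCompact.prod H.compact_angular.isCompact)).image continuous_cylPoint

theorem of_mem_carrier (H : Cutoff χ b h) {x : R3} (hx : x ∈ carrier χ b h) :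
    planar x ∈ Complex.slitPlane ∧ x 2 ∈ tsupport χ ∧ Real.log ‖planar x‖ ∈ tsupport b ∧
      Complex.arg (planar x) ∈ tsupport h := by
  obtain ⟨q, ⟨h1, h2, h3⟩, rfl⟩ := hx
  have h4 := H.angular_subset h3
  rw [arg_planar_cylPoint q ⟨h4.1, h4.2.le⟩, log_norm_planar_cylPoint]
  refine ⟨mem_slitPlane_of_arg ?_ ?_, by simpa [cylPoint] using h1, h2, h3⟩
  · rw [planar_cylPoint, Complex.ofReal_cos, Complex.ofReal_sin, ← Complex.exp_mul_I]
    simp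
  · rw [arg_planar_cylPoint q ⟨h4.1, h4.2.le⟩]
    exact h4.2

theorem mem_carrier (H : Cutoff χ b h) {x : R3} (h1 : x 2 ∈ tsupport χ)
    (h2 : Real.log ‖planar x‖ ∈ tsupport b) (h3 : Complex.arg (planar x) ∈ tsupport h) :
    x ∈ carrier χ b h := by
  -- On the axis `Real.log 0 = 0`, which is not in `Iio 0`; this is why the radial support is kept
  -- negative.
  refine ⟨_, ⟨h1, h2, h3⟩, cylPoint_eq fun h0 => ?_⟩
  have := H.neg_radial h2
  simp [h0] at this

theorem support_subset_carrier (H : Cutoff χ b h) : Function.support (pol χ b h) ⊆ carrier χ b h := by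
  intro x hx
  simp only [pol, Function.mem_support, ne_eq, mul_eq_zero, not_or] at hx
  exact H.mem_carrier (subset_tsupport _ hx.1.1) (subset_tsupport _ hx.1.2) (subset_tsupport _ hx.2)

theorem tsupport_subset_carrier (H : Cutoff χ b h) : tsupport (pol χ b h) ⊆ carrier χ b h :=
  closure_minimal H.support_subset_carrier H.isCompact_carrier.isClosed

theorem hasCompactSupport (H : Cutoff χ b h) : HasCompactSupport (pol χ b h) :=
  HasCompactSupport.of_support_subset_isCompact H.isCompact_carrier H.support_subset_carrier

/-- On the carrier, log r and θ are the real and imaginary parts of the principal logarithm, smooth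
on the slit plane; off it the function vanishes locally. -/
theorem contDiff (H : Cutoff χ b h) : ContDiff ℝ ∞ (pol χ b h) := by
  rw [contDiff_iff_contDiffAt]
  intro x
  by_cases hx : x ∈ carrier χ b h
  · have hz := (H.of_mem_carrier hx).1
    have hlog : ContDiffAt ℝ ∞ (fun y : R3 => Complex.log (planar y)) x :=
      ((Complex.contDiffAt_log hz).restrict_scalars ℝ).comp x planar.contDiff.contDiffAt
    have h1 : ContDiffAt ℝ ∞ (fun y : R3 => Real.log ‖planar y‖) x := by
      simpa only [Function.comp_def, Complex.reCLM_apply, Complex.log_re] using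
        Complex.reCLM.contDiff.contDiffAt.comp x hlog
    have h2 : ContDiffAt ℝ ∞ (fun y : R3 => Complex.arg (planar y)) x := by
      simpa only [Function.comp_def, Complex.imCLM_apply, Complex.log_im] using
        Complex.imCLM.contDiff.contDiffAt.comp x hlog
    have h3 : ContDiffAt ℝ ∞ (fun y : R3 => y 2) x :=
      (EuclideanSpace.proj (𝕜 := ℝ) (2 : Fin 3)).contDiff.contDiffAt
    exact ((H.smooth_axial.contDiffAt.comp x h3).mul (H.smooth_radial.contDiffAt.comp x h1)).mul
      (H.smooth_angular.contDiffAt.comp x h2)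
  · have : pol χ b h =ᶠ[nhds x] fun _ => 0 :=
      notMem_tsupport_iff_eventuallyEq.1 fun h' => hx (H.tsupport_subset_carrier h')
    exact contDiffAt_const.congr_of_eventuallyEq this

end Cutoff

/-- The partial derivative in the direction of a coordinate axis. -/
noncomputable def pd (i : Fin 3) (f : R3 → ℂ) (x : R3) : ℂ :=
  fderiv ℝ f x (EuclideanSpace.single i 1)

theorem hasFDerivAt_pol {χ b h : ℝ → ℂ} (H : Cutoff χ b h) {x : R3}
    (hz : planar x ∈ Complex.slitPlane) (v : R3) :
    fderiv ℝ (pol χ b h) x v =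
      (v 2 * deriv χ (x 2)) * b (Real.log ‖planar x‖) * h (Complex.arg (planar x))
      + χ (x 2) * (((planar x)⁻¹ * planar v).re * deriv b (Real.log ‖planar x‖))
          * h (Complex.arg (planar x))
      + χ (x 2) * b (Real.log ‖planar x‖) *
          (((planar x)⁻¹ * planar v).im * deriv h (Complex.arg (planar x))) := by
  have hlog : HasFDerivAt (fun y : R3 => Complex.log (planar y))
      (((planar x)⁻¹ • (1 : ℂ →L[ℝ] ℂ)) ∘L planar) x :=
    (Complex.hasStrictFDerivAt_log_real hz).hasFDerivAt.comp x planar.hasFDerivAt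
  have h1 : HasFDerivAt (fun y : R3 => Real.log ‖planar y‖)
      (Complex.reCLM ∘L (((planar x)⁻¹ • (1 : ℂ →L[ℝ] ℂ)) ∘L planar)) x := by
    simpa only [Function.comp_def, Complex.reCLM_apply, Complex.log_re] using
      Complex.reCLM.hasFDerivAt.comp x hlog
  have h2 : HasFDerivAt (fun y : R3 => Complex.arg (planar y))
      (Complex.imCLM ∘L (((planar x)⁻¹ • (1 : ℂ →L[ℝ] ℂ)) ∘L planar)) x := by
    simpa only [Function.comp_def, Complex.imCLM_apply, Complex.log_im] using
      Complex.imCLM.hasFDerivAt.comp x hlog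
  have h3 : HasFDerivAt (fun y : R3 => y 2) (EuclideanSpace.proj (𝕜 := ℝ) (2 : Fin 3)) x :=
    (EuclideanSpace.proj (𝕜 := ℝ) (2 : Fin 3)).hasFDerivAt
  have e1 := (H.smooth_axial.differentiable (by simp) (x 2)).hasDerivAt.hasFDerivAt.comp x h3
  have e2 := (H.smooth_radial.differentiable (by simp) _).hasDerivAt.hasFDerivAt.comp x h1
  have e3 := (H.smooth_angular.differentiable (by simp) _).hasDerivAt.hasFDerivAt.comp x h2
  have e := (e1.mul e2).mul e3
  have e' : fderiv ℝ (pol χ b h) x = _ := e.fderiv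
  rw [e']
  simp
  ring

end Cosserat

/-! ### Wirtinger derivatives in cylindrical coordinates -/

namespace Cosserat

open scoped ContDiff
open Set

/-- Smooth functions with compact support in `S`. -/
structure Cut (S : Set ℝ) (f : ℝ → ℂ) : Prop where
  smooth : ContDiff ℝ ∞ f
  compact : HasCompactSupport f
  subset : tsupport f ⊆ S

namespace Cut

variable {S : Set ℝ} {f g : ℝ → ℂ}

theorem cutoff {χ b h : ℝ → ℂ} (hχ : Cut univ χ) (hb : Cut (Iio 0) b)
    (hh : Cut (Ioo (-Real.pi) Real.pi) h) : Cutoff χ b h :=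
  ⟨hχ.1, hχ.2, hb.1, hb.2, hb.3, hh.1, hh.2, hh.3⟩

theorem mono {T : Set ℝ} (hf : Cut S f) (h : S ⊆ T) : Cut T f := ⟨hf.1, hf.2, hf.3.trans h⟩

theorem deriv (hf : Cut S f) : Cut S (deriv f) :=
  ⟨(contDiff_infty_iff_deriv.1 hf.1).2, hf.2.deriv, tsupport_deriv_subset.trans hf.3⟩

theorem mul (hf : Cut S f) (hg : ContDiff ℝ ∞ g) : Cut S fun t => f t * g t :=
  ⟨hf.1.mul hg, hf.2.mul_right, (tsupport_mul_subset_left).trans hf.3⟩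

theorem const_mul (hf : Cut S f) (c : ℂ) : Cut S fun t => c * f t := by
  simpa only [mul_comm] using hf.mul (g := fun _ => c) contDiff_const

theorem add (hf : Cut S f) (hg : Cut S g) : Cut S fun t => f t + g t :=
  ⟨hf.1.add hg.1, hf.2.add hg.2, (tsupport_add f g).trans (union_subset hf.3 hg.3)⟩

theorem sub (hf : Cut S f) (hg : Cut S g) : Cut S fun t => f t - g t := by
  simpa [sub_eq_add_neg] using hf.add (hg.const_mul (-1))

theorem comp_neg {a : ℝ} (hf : Cut (Ioo (-a) a) f) : Cut (Ioo (-a) a) fun t => f (-t) := by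
  have h := tsupport_comp_eq_preimage f (Homeomorph.neg ℝ)
  refine ⟨hf.1.comp contDiff_neg, hf.2.comp_homeomorph (Homeomorph.neg ℝ), ?_⟩
  change tsupport (f ∘ (Homeomorph.neg ℝ)) ⊆ _
  rw [h]
  intro t ht
  have := hf.3 ht
  simp at this
  constructor <;> linarith [this.1, this.2]

theorem eq_zero (hf : Cut S f) {t : ℝ} (ht : t ∉ S) : f t = 0 :=
  image_eq_zero_of_notMem_tsupport fun h => ht (hf.3 h)

end Cut

/-- The function `exp (-t)` with complex values. -/
noncomputable def expNeg (t : ℝ) : ℂ := Real.exp (-t)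

theorem contDiff_expNeg : ContDiff ℝ ∞ expNeg :=
  Complex.ofRealCLM.contDiff.comp (Real.contDiff_exp.comp contDiff_neg)

/-- The function `exp (-iιθ)`. -/
noncomputable def phase (ι θ : ℝ) : ℂ := Real.cos θ - ι * Complex.I * Real.sin θ

theorem contDiff_phase (ι : ℝ) : ContDiff ℝ ∞ (phase ι) := by
  unfold phase
  exact (Complex.ofRealCLM.contDiff.comp Real.contDiff_cos).sub
    (contDiff_const.mul (Complex.ofRealCLM.contDiff.comp Real.contDiff_sin))

/-- The operators `(∂₁ - i ι ∂₂) / 2`, that is, `∂/∂z` for `ι = 1` and `∂/∂z̄` for `ι = -1`. -/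
noncomputable def dz (ι : ℝ) (f : R3 → ℂ) (x : R3) : ℂ := (pd 0 f x - ι * Complex.I * pd 1 f x) / 2

/-- The function `χ(x₃) b(log r) h(θ) / r` in cylindrical coordinates. -/
noncomputable def wpol (χ b h : ℝ → ℂ) (x : R3) : ℂ := pol χ (fun t => b t * expNeg t) h x

variable {χ b h : ℝ → ℂ}

theorem inv_of_slitPlane {z : ℂ} (hz : z ∈ Complex.slitPlane) :
    z⁻¹ = ⟨Real.exp (-Real.log ‖z‖) * Real.cos z.arg, -(Real.exp (-Real.log ‖z‖) * Real.sin z.arg)⟩ := by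
  have h0 : z ≠ 0 := Complex.slitPlane_ne_zero hz
  have h1 : 0 < ‖z‖ := by positivity
  have h2 := Complex.norm_mul_cos_arg z
  have h3 := Complex.norm_mul_sin_arg z
  rw [Real.exp_neg, Real.exp_log h1]
  apply Complex.ext
  · rw [Complex.inv_re, Complex.normSq_eq_norm_sq, ← h2]
    field_simp
  · rw [Complex.inv_im, Complex.normSq_eq_norm_sq, ← h3]
    field_simp

theorem pol_eq_zero (hb : Cut (Iio 0) b) (hh : Cut (Ioo (-Real.pi) Real.pi) h) {x : R3}
    (hz : planar x ∉ Complex.slitPlane) : pol χ b h x = 0 := by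
  by_cases h0 : planar x = 0
  -- On the axis the logarithm takes its default value 0, where `b` vanishes.
  · simp [pol, h0, hb.eq_zero (t := 0) (by simp)]
  · have : Complex.arg (planar x) = Real.pi := by
      by_contra h1
      exact hz (Complex.mem_slitPlane_iff_arg.2 ⟨h1, h0⟩)
    simp [pol, this, hh.eq_zero (t := Real.pi) (by simp)]

theorem fderiv_pol_eq_zero (H : Cutoff χ b h) {x : R3}
    (hz : planar x ∉ Complex.slitPlane) : fderiv ℝ (pol χ b h) x = 0 := by
  have : x ∉ tsupport (pol χ b h) := fun hx => hz (H.of_mem_carrier (H.tsupport_subset_carrier hx)).1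
  exact image_eq_zero_of_notMem_tsupport fun h => this (tsupport_fderiv_subset ℝ h)

theorem pd_pol_axial (hχ : Cut univ χ) (hb : Cut (Iio 0) b) (hh : Cut (Ioo (-Real.pi) Real.pi) h) :
    pd 2 (pol χ b h) = pol (deriv χ) b h := by
  ext x
  by_cases hz : planar x ∈ Complex.slitPlane
  · have : planar (EuclideanSpace.single 2 1) = 0 := by
      rw [planar_apply]
      apply Complex.ext <;> simp
    rw [pd, hasFDerivAt_pol (hχ.cutoff hb hh) hz, this]
    simp [pol]
  · rw [pol_eq_zero hb hh hz, pd, fderiv_pol_eq_zero (hχ.cutoff hb hh) hz]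
    simp

/-- In the variables t = log r and θ, the operator is (e^{-iιθ} / 2r)(∂_t - iι ∂_θ) for ι = ±1. The
factor 1/r goes into `wpol`, the phase into the angular factor. -/
theorem dz_pol (hχ : Cut univ χ) (hb : Cut (Iio 0) b) (hh : Cut (Ioo (-Real.pi) Real.pi) h)
    {ι : ℝ} (hι : ι * ι = 1) (x : R3) :
    dz ι (pol χ b h) x = (wpol χ (deriv b) (fun θ => h θ * phase ι θ) x
      - ι * Complex.I * wpol χ b (fun θ => deriv h θ * phase ι θ) x) / 2 := by
  by_cases hz : planar x ∈ Complex.slitPlane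
  · have h0 : planar (EuclideanSpace.single 0 1) = 1 := by
      rw [planar_apply]
      apply Complex.ext <;> simp
    have h1 : planar (EuclideanSpace.single 1 1) = Complex.I := by
      rw [planar_apply]
      apply Complex.ext <;> simp
    rw [dz, pd, pd, hasFDerivAt_pol (hχ.cutoff hb hh) hz, hasFDerivAt_pol (hχ.cutoff hb hh) hz, h0,
      h1, inv_of_slitPlane hz]
    have hι' : (ι : ℂ) * ι = 1 := by exact_mod_cast hι
    have hI := Complex.I_mul_I
    simp [pol, wpol, expNeg, phase]
    linear_combination (exp := 1) (χ (x 2) * b (Real.log ‖planar x‖) *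
      (Complex.exp (-Real.log ‖planar x‖) * (Complex.sin (planar x).arg)
        * deriv h (planar x).arg) / 2) * (-2 * Complex.I * Complex.I * hι' - 2 * hI)
  · have hc : Cut (Ioo (-Real.pi) Real.pi) (fun θ => deriv h θ * phase ι θ) :=
      hh.deriv.mul (contDiff_phase ι)
    rw [wpol, wpol, pol_eq_zero (hb.mul contDiff_expNeg) hc hz,
      pol_eq_zero (hb.deriv.mul contDiff_expNeg) (hh.mul (contDiff_phase ι)) hz, dz, pd, pd,
      fderiv_pol_eq_zero (hχ.cutoff hb hh) hz]
    simp

/-! ### Integration in cylindrical coordinates -/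

theorem integral_radial (g : ℝ → ℝ) :
    ∫ r in Ioi (0 : ℝ), r * g (Real.log r) = ∫ t, g t * Real.exp (2 * t) := by
  have h := integral_image_eq_integral_abs_deriv_smul (s := univ) (f := Real.exp) (f' := Real.exp)
    MeasurableSet.univ (fun x _ => (Real.hasDerivAt_exp x).hasDerivWithinAt)
    Real.exp_injective.injOn (fun r => r * g (Real.log r))
  rw [image_univ, Real.range_exp] at h
  rw [h, setIntegral_univ]
  congr 1 with t
  rw [abs_of_pos (Real.exp_pos t), Real.log_exp, smul_eq_mul, two_mul, Real.exp_add]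
  ring

theorem integral_planar (g k : ℝ → ℝ) :
    ∫ z : ℂ, g (Real.log ‖z‖) * k (Complex.arg z) =
      (∫ t, g t * Real.exp (2 * t)) * ∫ θ in Ioo (-Real.pi) Real.pi, k θ := by
  rw [← Complex.integral_comp_polarCoord_symm, ← integral_radial, ← setIntegral_prod_mul]
  refine setIntegral_congr_fun (measurableSet_Ioi.prod measurableSet_Ioo) fun p hp => ?_
  have hp1 : 0 < p.1 := hp.1
  have h1 : Complex.arg (Complex.polarCoord.symm p) = p.2 := by
    rw [Complex.polarCoord_symm_apply, Complex.ofReal_cos, Complex.ofReal_sin]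
    exact Complex.arg_mul_cos_add_sin_mul_I hp1 ⟨hp.2.1, hp.2.2.le⟩
  simp only [Complex.norm_polarCoord_symm, h1, abs_of_pos hp1, smul_eq_mul]
  ring

/-- Fubini and r = e^t, so that r dr = e^{2t} dt. No integrability is needed: the product formula
for Bochner integrals also holds with their default value 0. -/
theorem integral_cylindrical (f g k : ℝ → ℝ) :
    ∫ x : R3, f (x 2) * g (Real.log ‖planar x‖) * k (Complex.arg (planar x)) =
      (∫ w, f w) * (∫ t, g t * Real.exp (2 * t)) * ∫ θ in Ioo (-Real.pi) Real.pi, k θ := by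
  have e1 := EuclideanSpace.volume_preserving_symm_measurableEquiv_toLp (Fin 3)
  have e2 := volume_preserving_piFinSuccAbove (fun _ : Fin 3 => ℝ) 2
  have e3 := Complex.volume_preserving_equiv_pi
  have h3 : ∫ y : Fin 2 → ℝ, g (Real.log ‖(⟨y 0, y 1⟩ : ℂ)‖) * k (Complex.arg ⟨y 0, y 1⟩) =
      ∫ z : ℂ, g (Real.log ‖z‖) * k (Complex.arg z) := by
    rw [← e3.integral_comp']
    rfl
  rw [mul_assoc, ← integral_planar, ← h3, ← integral_prod_mul, ← Measure.volume_eq_prod,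
    ← e2.integral_comp', ← e1.integral_comp']
  congr 1 with x
  rw [mul_assoc, planar_apply]
  rfl

end Cosserat

/-! ### L² estimates with the weight 1/r -/

namespace Cosserat

open scoped ContDiff
open Set

theorem norm_integral_mul_le {α : Type*} [MeasurableSpace α] {μ : Measure α} {f g : α → ℂ}
    (hf : MemLp f 2 μ) (hg : MemLp g 2 μ) :
    ‖∫ x, f x * g x ∂μ‖ ≤ √(∫ x, ‖f x‖ ^ 2 ∂μ) * √(∫ x, ‖g x‖ ^ 2 ∂μ) := by
  have h2 : Real.HolderConjugate 2 2 := Real.HolderConjugate.two_two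
  have h := integral_mul_le_Lp_mul_Lq_of_nonneg (μ := μ) h2 (f := fun x => ‖f x‖)
    (g := fun x => ‖g x‖) (Filter.Eventually.of_forall fun x => norm_nonneg _)
    (Filter.Eventually.of_forall fun x => norm_nonneg _) (by simpa using hf.norm) (by simpa using hg.norm)
  calc ‖∫ x, f x * g x ∂μ‖ ≤ ∫ x, ‖f x‖ * ‖g x‖ ∂μ := by
        simpa only [norm_mul] using norm_integral_le_integral_norm (μ := μ) fun x => f x * g x
    _ ≤ _ := by simpa [Real.sqrt_eq_rpow] using h

/-- The square of the `L²` norm over `I`. -/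
noncomputable def sqNorm (I : Set ℝ) (f : ℝ → ℂ) : ℝ := ∫ t in I, ‖f t‖ ^ 2

theorem sqNorm_nonneg (I : Set ℝ) (f : ℝ → ℂ) : 0 ≤ sqNorm I f :=
  integral_nonneg fun _ => by positivity

/-- The set of all points whose angle is in `I`. -/
def sector (I : Set ℝ) : Set R3 := {x | Complex.arg (planar x) ∈ I}

theorem measurableSet_sector {I : Set ℝ} (hI : MeasurableSet I) : MeasurableSet (sector I) :=
  (Complex.measurable_arg.comp planar.continuous.measurable) hI

variable {χ b h : ℝ → ℂ}

/-- The square of the weight 1/r cancels the density e^{2t}. The norm therefore factorizes, and is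
invariant under translations of `b`, that is, dilations about the edge. -/
theorem integral_wpol_sq {I : Set ℝ} (hI : MeasurableSet I)
    (hs : I ⊆ Ioo (-Real.pi) Real.pi) :
    ∫ x in sector I, ‖wpol χ b h x‖ ^ 2 = sqNorm univ χ * sqNorm univ b * sqNorm I h := by
  have e := integral_cylindrical (fun w => ‖χ w‖ ^ 2) (fun t => ‖b t * expNeg t‖ ^ 2)
    (I.indicator fun θ => ‖h θ‖ ^ 2)
  rw [setIntegral_indicator hI, inter_eq_right.2 hs] at e
  rw [← integral_indicator (measurableSet_sector hI), sqNorm, sqNorm, setIntegral_univ,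
    setIntegral_univ, sqNorm]
  have e2 : ∀ t, ‖b t * expNeg t‖ ^ 2 * Real.exp (2 * t) = ‖b t‖ ^ 2 := fun t => by
    rw [expNeg, norm_mul, Complex.norm_real, Real.norm_eq_abs, abs_of_pos (Real.exp_pos _), mul_pow,
      mul_assoc, ← Real.exp_nat_mul, ← Real.exp_add]
    simp
  simp only [e2] at e
  rw [← e]
  congr 1 with x
  by_cases hx : x ∈ sector I
  · have hx' : Complex.arg (planar x) ∈ I := hx
    simp [hx, hx', wpol, pol]
    ring
  · have hx' : Complex.arg (planar x) ∉ I := hx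
    simp [hx, hx']

theorem cutoff_wpol (hχ : Cut univ χ) (hb : Cut (Iio 0) b) (hh : Cut (Ioo (-Real.pi) Real.pi) h) :
    Cutoff χ (fun t => b t * expNeg t) h :=
  hχ.cutoff (hb.mul contDiff_expNeg) hh

theorem memLp_wpol (hχ : Cut univ χ) (hb : Cut (Iio 0) b) (hh : Cut (Ioo (-Real.pi) Real.pi) h) :
    MemLp (wpol χ b h) 2 volume :=
  (cutoff_wpol hχ hb hh).contDiff.continuous.memLp_of_hasCompactSupport
    (cutoff_wpol hχ hb hh).hasCompactSupport

/-- Cauchy–Schwarz after restriction to the sector, where the product lives. The angular factor may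
thus extend beyond `I` without being charged for it. -/
theorem norm_integral_wpol_mul_le {I : Set ℝ} (hI : MeasurableSet I)
    (hs : I ⊆ Ioo (-Real.pi) Real.pi) (hχ : Cut univ χ) (hb : Cut (Iio 0) b)
    (hh : Cut (Ioo (-Real.pi) Real.pi) h) {g : R3 → ℂ} (hg : MemLp g 2 volume)
    (hgI : ∀ x, wpol χ b h x ≠ 0 → g x ≠ 0 → x ∈ sector I) :
    ‖∫ x, wpol χ b h x * g x‖ ≤
      √(sqNorm univ χ * sqNorm univ b * sqNorm I h) * √(∫ x, ‖g x‖ ^ 2) := by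
  have e : ∀ x, wpol χ b h x * g x = (sector I).indicator (wpol χ b h) x * g x := fun x => by
    by_cases hx : x ∈ sector I
    · simp [hx]
    · by_cases h1 : wpol χ b h x = 0
      · simp [h1, hx]
      · by_cases h2 : g x = 0
        · simp [h2]
        · exact absurd (hgI x h1 h2) hx
  simp only [e]
  refine (norm_integral_mul_le ((memLp_wpol hχ hb hh).indicator (measurableSet_sector hI)) hg).trans
    (le_of_eq ?_)
  congr 2
  rw [← integral_wpol_sq hI hs, ← integral_indicator (measurableSet_sector hI)]
  congr 1 with x
  by_cases hx : x ∈ sector I <;> simp [hx]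

/-! ### Integration by parts and null Lagrangians -/

section PartialDerivatives

variable {f g : R3 → ℂ}

theorem contDiff_pd (hf : ContDiff ℝ ∞ f) (i : Fin 3) : ContDiff ℝ ∞ (pd i f) :=
  (hf.fderiv_right (m := ∞) (by simp)).clm_apply contDiff_const

theorem hasCompactSupport_pd (hf : HasCompactSupport f) (i : Fin 3) : HasCompactSupport (pd i f) :=
  hf.fderiv_apply ℝ _

theorem pd_comm (hf : ContDiff ℝ ∞ f) (i j : Fin 3) : pd i (pd j f) = pd j (pd i f) := by
  ext x
  have hd : DifferentiableAt ℝ (fderiv ℝ f) x :=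
    (hf.fderiv_right (m := ∞) (by simp)).differentiable (by simp) x
  have h (i j : Fin 3) : pd i (pd j f) x =
      fderiv ℝ (fderiv ℝ f) x (EuclideanSpace.single i 1) (EuclideanSpace.single j 1) := by
    change fderiv ℝ (fun y => fderiv ℝ f y (EuclideanSpace.single j 1)) x _ = _
    rw [fderiv_clm_apply hd (differentiableAt_const _)]
    simp
  rw [h, h]
  exact (hf.contDiffAt.isSymmSndFDerivAt (by simpa using ENat.LEInfty.out)).eq _ _

theorem integrable_mul_of_smooth (hf : ContDiff ℝ ∞ f) (hg : ContDiff ℝ ∞ g)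
    (hc : HasCompactSupport f) : Integrable fun x => f x * g x :=
  (hf.continuous.mul hg.continuous).integrable_of_hasCompactSupport hc.mul_right

theorem integral_mul_pd (hf : ContDiff ℝ ∞ f) (hg : ContDiff ℝ ∞ g) (hc : HasCompactSupport f)
    (i : Fin 3) : ∫ x, f x * pd i g x = -∫ x, pd i f x * g x := by
  refine integral_mul_fderiv_eq_neg_fderiv_mul_of_integrable ?_ ?_ ?_ ?_ ?_
  · exact integrable_mul_of_smooth (contDiff_pd hf i) hg (hasCompactSupport_pd hc i)
  · exact integrable_mul_of_smooth hf (contDiff_pd hg i) hc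
  · exact integrable_mul_of_smooth hf hg hc
  · exact fun x _ => hf.differentiable (by simp) x
  · exact fun x _ => hg.differentiable (by simp) x

theorem integral_pd_mul_pd_comm (hf : ContDiff ℝ ∞ f) (hg : ContDiff ℝ ∞ g)
    (hc : HasCompactSupport f) (i j : Fin 3) :
    ∫ x, pd i f x * pd j g x = ∫ x, pd j f x * pd i g x := by
  have h1 := integral_mul_pd hf (contDiff_pd hg j) hc i
  have h2 := integral_mul_pd hf (contDiff_pd hg i) hc j
  rw [pd_comm hg] at h1
  rw [h1] at h2
  exact neg_injective h2

theorem contDiff_dz (hf : ContDiff ℝ ∞ f) (ι : ℝ) : ContDiff ℝ ∞ (dz ι f) :=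
  ((contDiff_pd hf 0).sub (contDiff_const.mul (contDiff_pd hf 1))).div_const 2

theorem hasCompactSupport_dz (hf : HasCompactSupport f) (ι : ℝ) : HasCompactSupport (dz ι f) := by
  have h := (hasCompactSupport_pd hf 0).sub
    (HasCompactSupport.mul_left (f := fun _ => ι * Complex.I) (hasCompactSupport_pd hf 1))
  exact h.mono fun x hx => by
    contrapose! hx
    simp only [Function.mem_support, not_not, Pi.sub_apply, Pi.mul_apply] at hx ⊢
    simp [dz, hx]

/-- The integrands differ by a multiple of the Jacobian ∂₁f ∂₂g - ∂₂f ∂₁g, whose integral vanishes.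
-/
theorem integral_dz_mul_dz_comm (hf : ContDiff ℝ ∞ f) (hg : ContDiff ℝ ∞ g)
    (hc : HasCompactSupport f) (ι : ℝ) :
    ∫ x, dz ι f x * dz (-ι) g x = ∫ x, dz (-ι) f x * dz ι g x := by
  have i1 (i j : Fin 3) : Integrable fun x => pd i f x * pd j g x :=
    integrable_mul_of_smooth (contDiff_pd hf i) (contDiff_pd hg j) (hasCompactSupport_pd hc i)
  rw [← sub_eq_zero, ← integral_sub
    (integrable_mul_of_smooth (contDiff_dz hf _) (contDiff_dz hg _) (hasCompactSupport_dz hc _))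
    (integrable_mul_of_smooth (contDiff_dz hf _) (contDiff_dz hg _) (hasCompactSupport_dz hc _))]
  have e : ∀ x, dz ι f x * dz (-ι) g x - dz (-ι) f x * dz ι g x =
      (ι * Complex.I / 2) * (pd 0 f x * pd 1 g x - pd 1 f x * pd 0 g x) := fun x => by
    simp only [dz, Complex.ofReal_neg]
    ring
  simp only [e]
  rw [integral_const_mul, integral_sub (i1 0 1) (i1 1 0), integral_pd_mul_pd_comm hf hg hc 0 1,
    sub_self, mul_zero]

end PartialDerivatives

end Cosserat

/-! ### A criterion for not being Fredholm -/

namespace Cosserat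

open scoped ContDiff
open Set

/-- If `v` inverts `T` modulo finite rank, `v ∘ T - id` is compact and has nearly equal values at
two members of the sequence. Since `v ∘ T` is small along the sequence, those two members are closer
than 1. -/
theorem not_isFredholm_of_separated {E F : Type*} [NormedAddCommGroup E] [NormedSpace ℂ E]
    [CompleteSpace E] [NormedAddCommGroup F] [NormedSpace ℂ F] [CompleteSpace F] (T : E →L[ℂ] F)
    (h : ∀ ε > 0, ∃ u : ℕ → E, (∀ k, ‖u k‖ = 1) ∧ (∀ k l, k < l → 1 ≤ ‖u k - u l‖) ∧
      ∀ k, ‖T (u k)‖ ≤ ε) : ¬ T.IsFredholm := by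
  intro hT
  obtain ⟨v, hv⟩ := hT.exists_isQuasiInverse
  have hfin := LinearMap.FiniteRangeSetoid.equiv_iff_hasFiniteRange.1 hv.1
  set G : E →ₗ[ℂ] E := (v : F →ₗ[ℂ] E) ∘ₗ (T : E →ₗ[ℂ] F) - LinearMap.id with hG
  have : FiniteDimensional ℂ (LinearMap.range G) := by
    exact Module.Finite.iff_fg.2 hfin.fg_range
  have : ProperSpace (LinearMap.range G) := FiniteDimensional.proper ℂ _
  -- This makes `‖v (T (u k))‖ ≤ 1/4`; three errors of at most 1/4 stay below the separation 1.
  obtain ⟨u, hu1, hu2, hu3⟩ := h (1 / (4 * (‖v‖ + 1))) (by positivity)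
  have hv' : ∀ k, ‖v (T (u k))‖ ≤ 1 / 4 := fun k => by
    calc ‖v (T (u k))‖ ≤ ‖v‖ * ‖T (u k)‖ := v.le_opNorm _
      _ ≤ (‖v‖ + 1) * (1 / (4 * (‖v‖ + 1))) := by
        gcongr
        · linarith
        · exact hu3 k
      _ = 1 / 4 := by field_simp
  let w : ℕ → LinearMap.range G := fun k => ⟨G (u k), u k, rfl⟩
  have hw : ∀ k, (w k : E) = v (T (u k)) - u k := fun k => rfl
  have hb : ∀ k, w k ∈ Metric.closedBall (0 : LinearMap.range G) 2 := fun k => by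
    rw [mem_closedBall_zero_iff, Submodule.coe_norm, hw]
    calc _ ≤ ‖v (T (u k))‖ + ‖u k‖ := norm_sub_le _ _
      _ ≤ 2 := by linarith [hv' k, hu1 k]
  obtain ⟨a, -, φ, hφ, ha⟩ := tendsto_subseq_of_bounded Metric.isBounded_closedBall hb
  obtain ⟨N, hN⟩ := Metric.cauchySeq_iff'.1 ha.cauchySeq (1 / 4) (by norm_num)
  have h1 := hN (N + 1) (Nat.le_succ N)
  have h2 := hu2 _ _ (hφ (Nat.lt_succ_self N))
  rw [Function.comp_apply, Function.comp_apply, dist_eq_norm, Submodule.coe_norm,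
    Submodule.coe_sub, hw, hw] at h1
  have e : u (φ N) - u (φ (N + 1)) = (v (T (u (φ (N + 1)))) - u (φ (N + 1)) - (v (T (u (φ N))) - u (φ N)))
      - v (T (u (φ (N + 1)))) + v (T (u (φ N))) := by abel
  have h3 := (norm_add_le (v (T (u (φ (N + 1)))) - u (φ (N + 1)) - (v (T (u (φ N))) - u (φ N))
      - v (T (u (φ (N + 1))))) (v (T (u (φ N)))))
  have h4 := norm_sub_le (v (T (u (φ (N + 1)))) - u (φ (N + 1)) - (v (T (u (φ N))) - u (φ N)))
    (v (T (u (φ (N + 1)))))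
  rw [← e] at h3
  linarith [hv' (φ N), hv' (φ (N + 1))]

/-! ### The norm and the form on test fields -/

section TestFields

variable {Ω : Opens R3}

/-- The components of a test field. -/
def comp (u : TestField Ω) (k : Fin 3) : R3 → ℂ := fun x => u x k

theorem contDiff_comp (u : TestField Ω) (k : Fin 3) : ContDiff ℝ ∞ (comp u k) :=
  ((EuclideanSpace.proj (𝕜 := ℂ) k).restrictScalars ℝ).contDiff.comp (TestFunction.contDiff u)

theorem hasCompactSupport_comp (u : TestField Ω) (k : Fin 3) : HasCompactSupport (comp u k) :=
  (TestFunction.hasCompactSupport u).comp_left (g := fun y : C3 => y k) rfl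

theorem tsupport_component_subset (u : TestField Ω) (k : Fin 3) : tsupport (comp u k) ⊆ Ω :=
  (tsupport_comp_subset (g := fun y : C3 => y k) rfl u).trans (TestFunction.tsupport_subset u)

theorem jacobian_apply (u : TestField Ω) (x : R3) (k j : Fin 3) :
    jacobian u x (k, j) = pd j (comp u k) x := by
  have hd : DifferentiableAt ℝ (u : R3 → C3) x :=
    (TestFunction.contDiff u).differentiable (by simp) x
  have h := ((EuclideanSpace.proj (𝕜 := ℂ) k).restrictScalars ℝ).hasFDerivAt.comp x hd.hasFDerivAt
  have h' : fderiv ℝ (comp u k) x = _ := h.fderiv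
  rw [pd, h']
  rfl

theorem pd_comp_eq_zero (u : TestField Ω) (k j : Fin 3) {x : R3} (hx : x ∉ Ω) :
    pd j (comp u k) x = 0 := by
  have h : x ∉ tsupport (fderiv ℝ (comp u k)) :=
    fun h' => hx (tsupport_component_subset u k (tsupport_fderiv_subset ℝ h'))
  rw [pd, image_eq_zero_of_notMem_tsupport h]
  simp

theorem testGrad_ae (u : TestField Ω) :
    ∀ᵐ x ∂volume.restrict (Ω : Set R3), ∀ p, testGrad Ω u x p = pd p.2 (comp u p.1) x := by
  have h := (memLp_jacobian Ω u).coeFn_toLp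
  filter_upwards [h] with x hx p
  rw [← jacobian_apply]
  exact congrArg (fun y : C33 => y p) hx

theorem norm_coe_sq (u : TestField Ω) :
    ‖(u : H10 Ω)‖ ^ 2 = ∫ x, ∑ k, ∑ j, ‖pd j (comp u k) x‖ ^ 2 := by
  rw [UniformSpace.Completion.norm_coe]
  change ‖testGrad Ω u‖ ^ 2 = _
  have h := (L2.inner_def (𝕜 := ℂ) (testGrad Ω u) (testGrad Ω u)).symm
  rw [inner_self_eq_norm_sq_to_K] at h
  have h2 : ((∫ x in (Ω : Set R3), ∑ k, ∑ j, ‖pd j (comp u k) x‖ ^ 2 : ℝ) : ℂ) =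
      ((‖testGrad Ω u‖ : ℂ)) ^ 2 := by
    rw [← integral_complex_ofReal]
    refine Eq.trans (integral_congr_ae ?_) h
    filter_upwards [testGrad_ae u] with x hx
    rw [inner_self_eq_norm_sq_to_K, EuclideanSpace.norm_eq, ← Complex.coe_algebraMap, ← map_pow,
      Real.sq_sqrt (by positivity), Fintype.sum_prod_type]
    simp only [hx]
  rw [setIntegral_eq_integral_of_forall_compl_eq_zero] at h2
  · exact_mod_cast h2.symm
  · intro x hx
    simp [fun k j => pd_comp_eq_zero u k j hx]

theorem L_apply_coe (σ : ℂ) (u v : TestField Ω) :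
    L Ω σ u v = -σ * (∫ x, ∑ k, ∑ j, pd j (comp u k) x * pd j (comp v k) x)
      + ∫ x, (∑ k, pd k (comp u k) x) * (∑ k, pd k (comp v k) x) := by
  rw [L_apply, grad_coe, grad_coe]
  congr 1
  · congr 1
    refine Eq.trans (integral_congr_ae ?_) (setIntegral_eq_integral_of_forall_compl_eq_zero ?_)
    · filter_upwards [testGrad_ae u, testGrad_ae v] with x hx hy
      simp only [hx, hy]
    · intro x hx
      simp [fun k j => pd_comp_eq_zero u k j hx]
  · refine Eq.trans (integral_congr_ae ?_) (setIntegral_eq_integral_of_forall_compl_eq_zero ?_)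
    · filter_upwards [testGrad_ae u, testGrad_ae v] with x hx hy
      simp only [hx, hy]
    · intro x hx
      simp [fun k j => pd_comp_eq_zero u k j hx]

/-- Gradients with disjoint supports are orthogonal in L², so Pythagoras applies. This separates
fields in different shells. -/
theorem norm_le_norm_sub (u v : TestField Ω)
    (h : ∀ x k j l m, pd j (comp u k) x = 0 ∨ pd m (comp v l) x = 0) :
    ‖(u : H10 Ω)‖ ≤ ‖(u : H10 Ω) - (v : H10 Ω)‖ := by
  rw [← UniformSpace.Completion.coe_sub, UniformSpace.Completion.norm_coe,
    UniformSpace.Completion.norm_coe]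
  change ‖testGrad Ω u‖ ≤ ‖testGrad Ω (u - v)‖
  rw [map_sub]
  have h0 : inner ℂ (testGrad Ω u) (testGrad Ω v) = 0 := by
    rw [L2.inner_def]
    refine integral_eq_zero_of_ae ?_
    filter_upwards [testGrad_ae u, testGrad_ae v] with x hx hy
    rw [PiLp.inner_apply]
    refine Finset.sum_eq_zero fun p _ => ?_
    rw [hx, hy]
    rcases h x p.1 p.2 p.1 p.2 with h | h <;> simp [h]
  have h1 := norm_sub_sq (𝕜 := ℂ) (testGrad Ω u) (testGrad Ω v)
  rw [h0] at h1
  simp at h1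
  exact le_of_sq_le_sq (by nlinarith [sq_nonneg ‖testGrad Ω v‖]) (norm_nonneg _)

end TestFields

end Cosserat

/-! ### The Cosserat form in complex notation -/

namespace Cosserat

open scoped ContDiff
open Set

/-- Smooth complex functions with compact support. -/
structure Bump (f : R3 → ℂ) : Prop where
  smooth : ContDiff ℝ ∞ f
  compact : HasCompactSupport f

namespace Bump

variable {f g : R3 → ℂ}

theorem add (hf : Bump f) (hg : Bump g) : Bump fun x => f x + g x :=
  ⟨hf.1.add hg.1, hf.2.add hg.2⟩

theorem mul (hf : Bump f) (hg : Bump g) : Bump fun x => f x * g x :=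
  ⟨hf.1.mul hg.1, hf.2.mul_right⟩

theorem const_mul (hf : Bump f) (c : ℂ) : Bump fun x => c * f x :=
  ⟨contDiff_const.mul hf.1, HasCompactSupport.mul_left (f := fun _ => c) hf.2⟩

theorem sub (hf : Bump f) (hg : Bump g) : Bump fun x => f x - g x := by
  simpa [sub_eq_add_neg] using hf.add (hg.const_mul (-1))

theorem pd (hf : Bump f) (i : Fin 3) : Bump (pd i f) :=
  ⟨contDiff_pd hf.1 i, hasCompactSupport_pd hf.2 i⟩

theorem dz (hf : Bump f) (ι : ℝ) : Bump (dz ι f) :=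
  ⟨contDiff_dz hf.1 ι, hasCompactSupport_dz hf.2 ι⟩

theorem integrable (hf : Bump f) : Integrable f :=
  hf.1.continuous.integrable_of_hasCompactSupport hf.2

theorem memLp (hf : Bump f) : MemLp f 2 volume :=
  hf.1.continuous.memLp_of_hasCompactSupport hf.2

theorem pd_add (hf : Bump f) (hg : Bump g) (i : Fin 3) (x : R3) :
    Cosserat.pd i (fun x => f x + g x) x = Cosserat.pd i f x + Cosserat.pd i g x := by
  simp only [Cosserat.pd]
  rw [fderiv_fun_add (hf.1.differentiable (by simp) x) (hg.1.differentiable (by simp) x)]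
  rfl

theorem pd_const_mul (hf : Bump f) (c : ℂ) (i : Fin 3) (x : R3) :
    Cosserat.pd i (fun x => c * f x) x = c * Cosserat.pd i f x := by
  simp only [Cosserat.pd]
  rw [fderiv_const_mul (hf.1.differentiable (by simp) x)]
  rfl

end Bump

variable {Ω : Opens R3}

theorem bump_comp (u : TestField Ω) (k : Fin 3) : Bump (comp u k) :=
  ⟨contDiff_comp u k, hasCompactSupport_comp u k⟩

/-- The combination `u₁ + i ε u₂` of the first two components of a field. -/
def cc (ε : ℝ) (u : TestField Ω) (x : R3) : ℂ := comp u 0 x + (ε * Complex.I) * comp u 1 x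

theorem bump_cc (ε : ℝ) (u : TestField Ω) : Bump (cc ε u) :=
  (bump_comp u 0).add ((bump_comp u 1).const_mul _)

theorem pd_cc (ε : ℝ) (u : TestField Ω) (i : Fin 3) (x : R3) :
    pd i (cc ε u) x = pd i (comp u 0) x + (ε * Complex.I) * pd i (comp u 1) x := by
  have h := (bump_comp u 0).pd_add ((bump_comp u 1).const_mul (ε * Complex.I)) i x
  rw [(bump_comp u 1).pd_const_mul] at h
  exact h

theorem integral_sub_eq_zero {f g : R3 → ℂ} (hf : Bump f) (hg : Bump g)
    (h : ∫ x, f x = ∫ x, g x) : ∫ x, (f x - g x) = 0 := by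
  rw [integral_sub hf.integrable hg.integrable, h, sub_self]

/-- The form of the Cosserat operator on fields without third component, in complex notation. -/
theorem L_apply_complex (σ : ℂ) (u v : TestField Ω) (hu : comp u 2 = 0) :
    L Ω σ u v =
      (∫ x, (-(2 * σ - 1) * dz 1 (cc 1 u) x + dz (-1) (cc (-1) u) x) * dz (-1) (cc (-1) v) x)
      + (∫ x, (-(2 * σ - 1) * dz (-1) (cc (-1) u) x + dz 1 (cc 1 u) x) * dz 1 (cc 1 v) x)
      - σ / 2 * ((∫ x, pd 2 (cc 1 u) x * pd 2 (cc (-1) v) x)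
          + ∫ x, pd 2 (cc (-1) u) x * pd 2 (cc 1 v) x)
      + ((∫ x, pd 2 (cc 1 u) x * dz 1 (comp v 2) x)
          + ∫ x, pd 2 (cc (-1) u) x * dz (-1) (comp v 2) x) := by
  have hp := bump_cc 1 u
  have hm := bump_cc (-1) u
  have hP := bump_cc 1 v
  have hM := bump_cc (-1) v
  have hv := bump_comp v
  have hu' := bump_comp u
  have b1 := (((hp.dz 1).const_mul (-(2 * σ - 1))).add (hm.dz (-1))).mul (hM.dz (-1))
  have b2 := (((hm.dz (-1)).const_mul (-(2 * σ - 1))).add (hp.dz 1)).mul (hP.dz 1)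
  have b3 := (hp.pd 2).mul (hM.pd 2)
  have b4 := (hm.pd 2).mul (hP.pd 2)
  have b5 := (hp.pd 2).mul ((hv 2).dz 1)
  have b6 := (hm.pd 2).mul ((hv 2).dz (-1))
  -- Four null Lagrangians. The first two trade mixed Wirtinger products in grad u : grad v; the
  -- last two replace ∂ⱼuⱼ ∂₃v₃ by ∂₃uⱼ ∂ⱼv₃, leaving only axial derivatives of u beside v₃.
  have c1 := integral_sub_eq_zero ((hp.dz 1).mul (hM.dz (-1))) ((hp.dz (-1)).mul (hM.dz 1))
    (integral_dz_mul_dz_comm hp.1 hM.1 hp.2 1)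
  have c2 := integral_sub_eq_zero ((hm.dz 1).mul (hP.dz (-1))) ((hm.dz (-1)).mul (hP.dz 1))
    (integral_dz_mul_dz_comm hm.1 hP.1 hm.2 1)
  have c3 := integral_sub_eq_zero (((hu' 0).pd 0).mul ((hv 2).pd 2)) (((hu' 0).pd 2).mul ((hv 2).pd 0))
    (integral_pd_mul_pd_comm (hu' 0).1 (hv 2).1 (hu' 0).2 0 2)
  have c4 := integral_sub_eq_zero (((hu' 1).pd 1).mul ((hv 2).pd 2)) (((hu' 1).pd 2).mul ((hv 2).pd 1))
    (integral_pd_mul_pd_comm (hu' 1).1 (hv 2).1 (hu' 1).2 1 2)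
  have d1 := ((hp.dz 1).mul (hM.dz (-1))).sub ((hp.dz (-1)).mul (hM.dz 1))
  have d2 := ((hm.dz 1).mul (hP.dz (-1))).sub ((hm.dz (-1)).mul (hP.dz 1))
  have d3 := (((hu' 0).pd 0).mul ((hv 2).pd 2)).sub (((hu' 0).pd 2).mul ((hv 2).pd 0))
  have d4 := (((hu' 1).pd 1).mul ((hv 2).pd 2)).sub (((hu' 1).pd 2).mul ((hv 2).pd 1))
  have hz : ∀ i x, pd i (comp u 2) x = 0 := fun i x => by simp [hu, pd]
  have hA : Integrable fun x => ∑ k, ∑ j, pd j (comp u k) x * pd j (comp v k) x :=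
    integrable_finsetSum _ fun k _ => integrable_finsetSum _ fun j _ =>
      (((hu' k).pd j).mul ((hv k).pd j)).integrable
  have hB : Integrable fun x => (∑ k, pd k (comp u k) x) * (∑ k, pd k (comp v k) x) := by
    simp only [Finset.sum_mul_sum]
    exact integrable_finsetSum _ fun k _ => integrable_finsetSum _ fun j _ =>
      (((hu' k).pd k).mul ((hv j).pd j)).integrable
  rw [L_apply_coe, ← integral_const_mul, ← integral_add (hA.const_mul _) hB]
  have key : ∀ x, -σ * (∑ k, ∑ j, pd j (comp u k) x * pd j (comp v k) x)
        + (∑ k, pd k (comp u k) x) * (∑ k, pd k (comp v k) x) =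
      ((-(2 * σ - 1) * dz 1 (cc 1 u) x + dz (-1) (cc (-1) u) x) * dz (-1) (cc (-1) v) x
      + ((-(2 * σ - 1) * dz (-1) (cc (-1) u) x + dz 1 (cc 1 u) x) * dz 1 (cc 1 v) x)
      + (- (σ / 2) * (pd 2 (cc 1 u) x * pd 2 (cc (-1) v) x + pd 2 (cc (-1) u) x * pd 2 (cc 1 v) x))
      + (pd 2 (cc 1 u) x * dz 1 (comp v 2) x + pd 2 (cc (-1) u) x * dz (-1) (comp v 2) x))
      + (σ * ((dz 1 (cc 1 u) x * dz (-1) (cc (-1) v) x - dz (-1) (cc 1 u) x * dz 1 (cc (-1) v) x)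
        - (dz 1 (cc (-1) u) x * dz (-1) (cc 1 v) x - dz (-1) (cc (-1) u) x * dz 1 (cc 1 v) x))
      + ((pd 0 (comp u 0) x * pd 2 (comp v 2) x - pd 2 (comp u 0) x * pd 0 (comp v 2) x)
        + (pd 1 (comp u 1) x * pd 2 (comp v 2) x - pd 2 (comp u 1) x * pd 1 (comp v 2) x))) := by
    intro x
    simp only [dz, pd_cc, Fin.sum_univ_three, hz]
    push_cast
    have hI := Complex.I_sq
    have hI4 : Complex.I ^ 4 = 1 := Complex.I_pow_four
    ring_nf
    simp only [hI, hI4]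
    ring
  simp only [key]
  rw [integral_add ((((b1.add b2).add ((b3.add b4).const_mul _))).add (b5.add b6)).integrable
      (((d1.sub d2).const_mul _).add (d3.add d4)).integrable,
    integral_add (((d1.sub d2).const_mul _)).integrable (d3.add d4).integrable,
    integral_const_mul, integral_sub d1.integrable d2.integrable,
    integral_add d3.integrable d4.integrable, c1, c2, c3, c4,
    integral_add ((b1.add b2).add ((b3.add b4).const_mul _)).integrable (b5.add b6).integrable,
    integral_add (b1.add b2).integrable ((b3.add b4).const_mul _).integrable,
    integral_add b1.integrable b2.integrable, integral_const_mul,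
    integral_add b3.integrable b4.integrable, integral_add b5.integrable b6.integrable]
  ring

/-! ### Derivatives bounded by the H¹ seminorm -/

section NormBounds

theorem integrable_frobenius (v : TestField Ω) :
    Integrable fun x => ∑ k, ∑ j, ‖pd j (comp v k) x‖ ^ 2 :=
  integrable_finsetSum _ fun k _ => integrable_finsetSum _ fun j _ =>
    ((bump_comp v k).pd j).memLp.integrable_norm_pow (by simp)

theorem sqrt_integral_sq_le (v : TestField Ω) {g : R3 → ℂ}
    (h : ∀ x, ‖g x‖ ^ 2 ≤ 4 * ∑ k, ∑ j, ‖pd j (comp v k) x‖ ^ 2) :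
    √(∫ x, ‖g x‖ ^ 2) ≤ 2 * ‖(v : H10 Ω)‖ := by
  rw [Real.sqrt_le_left (by positivity), mul_pow, norm_coe_sq, ← integral_const_mul]
  refine integral_mono_of_nonneg (Filter.Eventually.of_forall fun x => by positivity)
    ((integrable_frobenius v).const_mul _) (Filter.Eventually.of_forall fun x => ?_)
  simpa [show (2 : ℝ) ^ 2 = 4 by norm_num] using h x

theorem norm_add_sq_le_two (a b : ℂ) : ‖a + b‖ ^ 2 ≤ 2 * (‖a‖ ^ 2 + ‖b‖ ^ 2) := by
  nlinarith [norm_add_le a b, norm_nonneg (a + b), norm_nonneg a, norm_nonneg b,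
    sq_nonneg (‖a‖ - ‖b‖)]

theorem norm_sq_pd_cc_le {ε : ℝ} (hε : |ε| = 1) (v : TestField Ω) (i : Fin 3) (x : R3) :
    ‖pd i (cc ε v) x‖ ^ 2 ≤ 2 * (‖pd i (comp v 0) x‖ ^ 2 + ‖pd i (comp v 1) x‖ ^ 2) := by
  rw [pd_cc]
  simpa [hε] using norm_add_sq_le_two (pd i (comp v 0) x) ((ε * Complex.I) * pd i (comp v 1) x)

theorem norm_sq_dz_le {ι : ℝ} (hι : |ι| = 1) (f : R3 → ℂ) (x : R3) :
    ‖dz ι f x‖ ^ 2 ≤ (‖pd 0 f x‖ ^ 2 + ‖pd 1 f x‖ ^ 2) / 2 := by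
  have h := norm_add_sq_le_two (pd 0 f x) (-(ι * Complex.I * pd 1 f x))
  rw [norm_neg, norm_mul, norm_mul, Complex.norm_I, Complex.norm_real, Real.norm_eq_abs, hι,
    ← sub_eq_add_neg] at h
  rw [dz, norm_div, div_pow]
  norm_num at h ⊢
  linarith

theorem sqrt_integral_pd_cc_le {ε : ℝ} (hε : |ε| = 1) (v : TestField Ω) (i : Fin 3) :
    √(∫ x, ‖pd i (cc ε v) x‖ ^ 2) ≤ 2 * ‖(v : H10 Ω)‖ := by
  refine sqrt_integral_sq_le v fun x => (norm_sq_pd_cc_le hε v i x).trans ?_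
  simp only [Fin.sum_univ_three]
  fin_cases i <;> simp <;> linarith
    [sq_nonneg ‖pd 0 (comp v 0) x‖, sq_nonneg ‖pd 1 (comp v 0) x‖, sq_nonneg ‖pd 2 (comp v 0) x‖,
    sq_nonneg ‖pd 0 (comp v 1) x‖, sq_nonneg ‖pd 1 (comp v 1) x‖, sq_nonneg ‖pd 2 (comp v 1) x‖,
    sq_nonneg ‖pd 0 (comp v 2) x‖, sq_nonneg ‖pd 1 (comp v 2) x‖, sq_nonneg ‖pd 2 (comp v 2) x‖]

theorem sqrt_integral_dz_cc_le {ι ε : ℝ} (hι : |ι| = 1) (hε : |ε| = 1) (v : TestField Ω) :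
    √(∫ x, ‖dz ι (cc ε v) x‖ ^ 2) ≤ 2 * ‖(v : H10 Ω)‖ := by
  refine sqrt_integral_sq_le v fun x => (norm_sq_dz_le hι _ x).trans ?_
  have h0 := norm_sq_pd_cc_le hε v 0 x
  have h1 := norm_sq_pd_cc_le hε v 1 x
  simp only [Fin.sum_univ_three]
  linarith
    [sq_nonneg ‖pd 0 (comp v 0) x‖, sq_nonneg ‖pd 1 (comp v 0) x‖, sq_nonneg ‖pd 2 (comp v 0) x‖,
    sq_nonneg ‖pd 0 (comp v 1) x‖, sq_nonneg ‖pd 1 (comp v 1) x‖, sq_nonneg ‖pd 2 (comp v 1) x‖,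
    sq_nonneg ‖pd 0 (comp v 2) x‖, sq_nonneg ‖pd 1 (comp v 2) x‖, sq_nonneg ‖pd 2 (comp v 2) x‖]

theorem sqrt_integral_dz_comp_le {ι : ℝ} (hι : |ι| = 1) (v : TestField Ω) :
    √(∫ x, ‖dz ι (comp v 2) x‖ ^ 2) ≤ 2 * ‖(v : H10 Ω)‖ := by
  refine sqrt_integral_sq_le v fun x => (norm_sq_dz_le hι _ x).trans ?_
  simp only [Fin.sum_univ_three]
  linarith
    [sq_nonneg ‖pd 0 (comp v 0) x‖, sq_nonneg ‖pd 1 (comp v 0) x‖, sq_nonneg ‖pd 2 (comp v 0) x‖,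
    sq_nonneg ‖pd 0 (comp v 1) x‖, sq_nonneg ‖pd 1 (comp v 1) x‖, sq_nonneg ‖pd 2 (comp v 1) x‖,
    sq_nonneg ‖pd 0 (comp v 2) x‖, sq_nonneg ‖pd 1 (comp v 2) x‖, sq_nonneg ‖pd 2 (comp v 2) x‖]

end NormBounds

end Cosserat

/-! ### The stress of an approximate solution -/

namespace Cosserat

open scoped ContDiff
open Set

theorem norm_integral_wpol_mul_le_of_support {I T : Set ℝ} (hI : MeasurableSet I)
    (hs : I ⊆ Ioo (-Real.pi) Real.pi) (hT : T ⊆ Iio 0) {χ b h : ℝ → ℂ} (hχ : Cut univ χ)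
    (hb : Cut T b) (hh : Cut (Ioo (-Real.pi) Real.pi) h) {g : R3 → ℂ} (hg : MemLp g 2 volume)
    (hgI : ∀ x, x 2 ∈ tsupport χ → Real.log ‖planar x‖ ∈ T → x ∉ sector I → g x = 0) :
    ‖∫ x, wpol χ b h x * g x‖ ≤
      √(sqNorm univ χ * sqNorm univ b * sqNorm I h) * √(∫ x, ‖g x‖ ^ 2) := by
  refine norm_integral_wpol_mul_le hI hs hχ (hb.mono hT) hh hg fun x hx hx' => ?_
  by_contra hS
  refine hx' (hgI x ?_ ?_ hS)
  · refine subset_tsupport _ fun h0 => hx ?_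
    simp [wpol, pol, h0]
  · by_contra h0
    exact hx (by simp [wpol, pol, hb.eq_zero h0])

/-- The operator `∂_ι` on a function whose radial factor is a modulated oscillation. -/
theorem dz_pol_of_deriv {T : Set ℝ} (hT : T ⊆ Iio 0) {χ b a h : ℝ → ℂ} {ι : ℝ} {c : ℂ}
    (hι : ι * ι = 1) (hχ : Cut univ χ) (hb : Cut T b) (hd : ∀ t, deriv b t = a t + c * b t)
    (hh : Cut (Ioo (-Real.pi) Real.pi) h) (x : R3) :
    dz ι (pol χ b h) x = (wpol χ a (fun θ => h θ * phase ι θ) x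
      + wpol χ b (fun θ => (c * h θ - ι * Complex.I * deriv h θ) * phase ι θ) x) / 2 := by
  rw [dz_pol hχ (hb.mono hT) hh hι]
  simp only [wpol, pol, hd]
  ring

theorem cut_angular {h : ℝ → ℂ} {ι : ℝ} {c : ℂ} {S : Set ℝ} (hh : Cut S h) :
    Cut S fun θ => (c * h θ - ι * Complex.I * deriv h θ) * phase ι θ :=
  ((hh.const_mul _).sub (hh.deriv.const_mul _)).mul (contDiff_phase ι)

theorem integrable_wpol_mul {T : Set ℝ} (hT : T ⊆ Iio 0) {χ b h : ℝ → ℂ} (hχ : Cut univ χ)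
    (hb : Cut T b) (hh : Cut (Ioo (-Real.pi) Real.pi) h) {g : R3 → ℂ} (hg : Bump g) :
    Integrable fun x => wpol χ b h x * g x :=
  have hc := cutoff_wpol hχ (hb.mono hT) hh
  (Bump.mul ⟨hc.contDiff, hc.hasCompactSupport⟩ hg).integrable

/-- The form of the Cosserat operator on an approximate solution: up to the terms in which the
radial cutoff is differentiated, only the defect `K₂` of the angular equation contributes. -/
theorem norm_integral_stress_le {I T : Set ℝ} (hI : MeasurableSet I)
    (hs : I ⊆ Ioo (-Real.pi) Real.pi) (hT : T ⊆ Iio 0) {χ b a h₁ h₂ h₃ : ℝ → ℂ} {s ι : ℝ} {c : ℂ}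
    (hι : ι * ι = 1) (hχ : Cut univ χ) (hb : Cut T b) (ha : Cut T a)
    (hd : ∀ t, deriv b t = a t + c * b t)
    (hh₁ : Cut (Ioo (-Real.pi) Real.pi) h₁) (hh₂ : Cut (Ioo (-Real.pi) Real.pi) h₂)
    (hh₃ : Cut (Ioo (-Real.pi) Real.pi) h₃)
    (h₃I : ∀ θ ∈ I, c * h₃ θ + ι * Complex.I * deriv h₃ θ = 0)
    {M : R3 → ℂ} (hM : Bump M)
    (hMI : ∀ x, x 2 ∈ tsupport χ → Real.log ‖planar x‖ ∈ T → x ∉ sector I → ∀ i, pd i M x = 0)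
    {K₁ K₂ : ℝ → ℂ}
    (hK₁ : K₁ = fun θ => (h₃ θ - s * h₁ θ) * phase ι θ + h₂ θ * phase (-ι) θ)
    (hK₂ : K₂ = fun θ => (c * (h₃ θ - s * h₁ θ)
        - ι * Complex.I * (deriv h₃ θ - s * deriv h₁ θ)) * phase ι θ
        + (c * h₂ θ + ι * Complex.I * deriv h₂ θ) * phase (-ι) θ) :
    ‖∫ x, (-s * dz ι (pol χ b h₁) x + dz (-ι) (pol χ b h₂) x) * dz (-ι) M x‖ ≤
      (√(sqNorm univ χ * sqNorm univ a * sqNorm I K₁)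
        + √(sqNorm univ χ * sqNorm univ b * sqNorm I K₂)) * √(∫ x, ‖dz (-ι) M x‖ ^ 2)
      + √(sqNorm univ χ * sqNorm univ a * sqNorm I fun θ => h₃ θ * phase (-ι) θ) *
          √(∫ x, ‖dz ι M x‖ ^ 2) := by
  have hι' : -ι * -ι = 1 := by linarith
  have hdz : ∀ j x, x 2 ∈ tsupport χ → Real.log ‖planar x‖ ∈ T → x ∉ sector I → dz j M x = 0 :=
    fun j x h1 h2 h3 => by simp [dz, hMI x h1 h2 h3]
  have cK₁ : Cut (Ioo (-Real.pi) Real.pi) K₁ := by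
    rw [hK₁]
    exact ((hh₃.sub (hh₁.const_mul s)).mul (contDiff_phase ι)).add (hh₂.mul (contDiff_phase _))
  have cK₂ : Cut (Ioo (-Real.pi) Real.pi) K₂ := by
    rw [hK₂]
    exact ((((hh₃.sub (hh₁.const_mul s)).const_mul c).sub
      ((hh₃.deriv.sub (hh₁.deriv.const_mul s)).const_mul _)).mul (contDiff_phase ι)).add
      (((hh₂.const_mul c).add (hh₂.deriv.const_mul _)).mul (contDiff_phase _))
  have c₃ : Cut (Ioo (-Real.pi) Real.pi) fun θ => h₃ θ * phase (-ι) θ := hh₃.mul (contDiff_phase _)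
  have c₄ : Cut (Ioo (-Real.pi) Real.pi) fun θ =>
      (c * h₃ θ - (-ι : ℝ) * Complex.I * deriv h₃ θ) * phase (-ι) θ := cut_angular hh₃
  have H₃ := hχ.cutoff (hb.mono hT) hh₃
  have B₃ : Bump (pol χ b h₃) := ⟨H₃.contDiff, H₃.hasCompactSupport⟩
  -- For an exact solution the stress equals -∂_ι W with ∂_{-ι} W = 0, where W = `pol χ b h₃` (for ι
  -- = 1, a multiple of z^{iξ}). Here -∂_ι W is split off; what remains is `K₁` with the small
  -- factor `a` and the defect `K₂`.
  have e1 : ∀ x, (-s * dz ι (pol χ b h₁) x + dz (-ι) (pol χ b h₂) x) * dz (-ι) M x =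
      (1 / 2) * (wpol χ a K₁ x * dz (-ι) M x + wpol χ b K₂ x * dz (-ι) M x)
        - dz ι (pol χ b h₃) x * dz (-ι) M x := fun x => by
    rw [dz_pol_of_deriv hT hι hχ hb hd hh₁, dz_pol_of_deriv hT hι' hχ hb hd hh₂,
      dz_pol_of_deriv hT hι hχ hb hd hh₃, hK₁, hK₂]
    simp only [wpol, pol, Complex.ofReal_neg]
    ring
  -- Exchanging the two operators puts ∂_{-ι} on W. It annihilates W up to the term with `a`, and
  -- `h₃` need not vanish at the faces because the derivatives of `M` do outside the sector.
  have e2 : ∫ x, dz ι (pol χ b h₃) x * dz (-ι) M x =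
      (1 / 2) * ((∫ x, wpol χ a (fun θ => h₃ θ * phase (-ι) θ) x * dz ι M x)
        + ∫ x, wpol χ b (fun θ =>
            (c * h₃ θ - (-ι : ℝ) * Complex.I * deriv h₃ θ) * phase (-ι) θ) x * dz ι M x) := by
    rw [integral_dz_mul_dz_comm B₃.1 hM.1 B₃.2, ← integral_add
      (integrable_wpol_mul hT hχ ha c₃ (hM.dz ι)) (integrable_wpol_mul hT hχ hb c₄ (hM.dz ι)),
      ← integral_const_mul]
    congr 1 with x
    rw [dz_pol_of_deriv hT hι' hχ hb hd hh₃]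
    ring
  have e3 : ∫ x, wpol χ b (fun θ =>
      (c * h₃ θ - (-ι : ℝ) * Complex.I * deriv h₃ θ) * phase (-ι) θ) x * dz ι M x = 0 := by
    refine integral_eq_zero_of_ae (Filter.Eventually.of_forall fun x => ?_)
    by_cases hx : x ∈ sector I
    · have h := h₃I _ hx
      simp only [wpol, pol, Complex.ofReal_neg, neg_mul, sub_neg_eq_add, h]
      simp
    · have h0 : wpol χ b (fun θ =>
          (c * h₃ θ - (-ι : ℝ) * Complex.I * deriv h₃ θ) * phase (-ι) θ) x = 0 ∨ dz ι M x = 0 := by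
        by_contra! h0
        refine h0.2 (hdz ι x ?_ ?_ hx)
        · exact subset_tsupport _ fun h1 => h0.1 (by simp [wpol, pol, h1])
        · by_contra h1
          exact h0.1 (by simp [wpol, pol, hb.eq_zero h1])
      simpa using h0
  have n1 := norm_integral_wpol_mul_le_of_support hI hs hT hχ ha cK₁ (hM.dz (-ι)).memLp (hdz _)
  have n2 := norm_integral_wpol_mul_le_of_support hI hs hT hχ hb cK₂ (hM.dz (-ι)).memLp (hdz _)
  have n3 := norm_integral_wpol_mul_le_of_support hI hs hT hχ ha c₃ (hM.dz ι).memLp (hdz _)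
  have i1 := integrable_wpol_mul hT hχ ha cK₁ (hM.dz (-ι))
  have i2 := integrable_wpol_mul hT hχ hb cK₂ (hM.dz (-ι))
  have i3 : Integrable fun x => (1 / 2 : ℂ) *
      (wpol χ a K₁ x * dz (-ι) M x + wpol χ b K₂ x * dz (-ι) M x) := (i1.add i2).const_mul _
  simp only [e1]
  rw [integral_sub i3 ((B₃.dz ι).mul (hM.dz (-ι))).integrable,
    integral_const_mul, integral_add i1 i2, e2, e3, add_zero, ← mul_sub, norm_mul]
  have t1 := norm_sub_le ((∫ x, wpol χ a K₁ x * dz (-ι) M x) + ∫ x, wpol χ b K₂ x * dz (-ι) M x)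
    (∫ x, wpol χ a (fun θ => h₃ θ * phase (-ι) θ) x * dz ι M x)
  have t2 := norm_add_le (∫ x, wpol χ a K₁ x * dz (-ι) M x) (∫ x, wpol χ b K₂ x * dz (-ι) M x)
  have t3 : ‖(1 / 2 : ℂ)‖ ≤ 1 := by norm_num
  refine (mul_le_of_le_one_left (norm_nonneg _) t3).trans ?_
  linarith

end Cosserat

/-! ### Angular cutoffs -/

namespace Cosserat

open scoped ContDiff
open Set Filter

section AngularCutoff

theorem exists_bound_deriv_smoothTransition :
    ∃ C, 0 ≤ C ∧ ∀ x, |deriv Real.smoothTransition x| ≤ C := by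
  have hc : Continuous (deriv Real.smoothTransition) :=
    (Real.smoothTransition.contDiff (n := 1)).continuous_deriv le_rfl
  have hs : HasCompactSupport (deriv Real.smoothTransition) := by
    refine HasCompactSupport.intro (isCompact_Icc (a := (0 : ℝ)) (b := 1)) fun x hx => ?_
    rw [mem_Icc, not_and_or, not_le, not_le] at hx
    rcases hx with hx | hx
    · have : Real.smoothTransition =ᶠ[nhds x] fun _ => 0 := by
        filter_upwards [Iio_mem_nhds hx] with y hy
        exact Real.smoothTransition.zero_of_nonpos (le_of_lt hy)
      rw [this.deriv_eq, deriv_const]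
    · have : Real.smoothTransition =ᶠ[nhds x] fun _ => 1 := by
        filter_upwards [Ioi_mem_nhds hx] with y hy
        exact Real.smoothTransition.one_of_one_le (le_of_lt hy)
      rw [this.deriv_eq, deriv_const]
  obtain ⟨C, hC⟩ := hs.exists_bound_of_continuous hc
  exact ⟨C, (norm_nonneg _).trans (hC 0), hC⟩

/-- A smooth cutoff function on `(-w, w)`, which tends to `1` as `n → ∞`. -/
noncomputable def angCut (w : ℝ) (n : ℕ) (θ : ℝ) : ℝ :=
  Real.smoothTransition ((n + 1) * (w ^ 2 - θ ^ 2) - 1)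

theorem contDiff_angCut (w : ℝ) (n : ℕ) : ContDiff ℝ ∞ (angCut w n) :=
  Real.smoothTransition.contDiff.comp (by fun_prop)

theorem deriv_angCut (w : ℝ) (n : ℕ) (θ : ℝ) : deriv (angCut w n) θ =
    deriv Real.smoothTransition ((n + 1) * (w ^ 2 - θ ^ 2) - 1) * ((n + 1) * -(2 * θ)) := by
  have h1 : HasDerivAt (fun θ : ℝ => ((n : ℝ) + 1) * (w ^ 2 - θ ^ 2) - 1) ((n + 1) * -(2 * θ)) θ := by
    have := (((hasDerivAt_pow 2 θ).const_sub (w ^ 2)).const_mul ((n : ℝ) + 1)).sub_const 1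
    simpa using this
  have h2 : HasDerivAt Real.smoothTransition _ ((n + 1) * (w ^ 2 - θ ^ 2) - 1) :=
    ((Real.smoothTransition.contDiff (n := 1)).differentiable (by simp) _).hasDerivAt
  exact (h2.comp θ h1).deriv

theorem deriv_angCut_eq_zero {w θ : ℝ} {n : ℕ} (h : 2 < (n + 1) * (w ^ 2 - θ ^ 2)) :
    deriv (angCut w n) θ = 0 := by
  have : Real.smoothTransition =ᶠ[nhds ((n + 1) * (w ^ 2 - θ ^ 2) - 1)] fun _ => 1 := by
    filter_upwards [Ioi_mem_nhds (show 1 < (n + 1) * (w ^ 2 - θ ^ 2) - 1 by linarith)] with y hy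
    exact Real.smoothTransition.one_of_one_le (le_of_lt hy)
  rw [deriv_angCut, this.deriv_eq, deriv_const, zero_mul]

theorem cut_angCut_mul {w : ℝ} (hw : 0 < w) (n : ℕ) {φ : ℝ → ℂ} (hφ : ContDiff ℝ ∞ φ) :
    Cut (Ioo (-w) w) fun θ => (angCut w n θ : ℂ) * φ θ := by
  have hn : (0 : ℝ) < n + 1 := by positivity
  set K : Set ℝ := {θ | 1 ≤ ((n : ℝ) + 1) * (w ^ 2 - θ ^ 2)} with hK
  have hcl : IsClosed K := isClosed_le continuous_const (by fun_prop)
  have hsub : K ⊆ Ioo (-w) w := fun θ hθ => by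
    have h1 : 0 < w ^ 2 - θ ^ 2 := by
      have : 0 < ((n : ℝ) + 1) * (w ^ 2 - θ ^ 2) := lt_of_lt_of_le one_pos hθ
      exact (mul_pos_iff_of_pos_left hn).1 this
    exact abs_lt.1 (abs_lt_of_sq_lt_sq (by linarith) hw.le)
  have hsup : Function.support (fun θ => (angCut w n θ : ℂ) * φ θ) ⊆ K := fun θ hθ => by
    by_contra h
    rw [hK, mem_ofPred_eq, not_le] at h
    exact hθ (by simp [angCut, Real.smoothTransition.zero_of_nonpos
      (show ((n : ℝ) + 1) * (w ^ 2 - θ ^ 2) - 1 ≤ 0 by linarith)])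
  have hcomp : IsCompact K :=
    isCompact_Icc.of_isClosed_subset hcl (hsub.trans Ioo_subset_Icc_self)
  exact ⟨(Complex.ofRealCLM.contDiff.comp (contDiff_angCut w n)).mul hφ,
    HasCompactSupport.of_support_subset_isCompact hcomp hsup, (closure_minimal hsup hcl).trans hsub⟩

theorem eventually_angCut {w θ : ℝ} (hθ : θ ∈ Ioo (-w) w) :
    ∀ᶠ n in atTop, angCut w n θ = 1 ∧ deriv (angCut w n) θ = 0 := by
  have h1 : 0 < w ^ 2 - θ ^ 2 := by nlinarith [hθ.1, hθ.2]
  obtain ⟨N, hN⟩ := exists_nat_gt (2 / (w ^ 2 - θ ^ 2))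
  filter_upwards [eventually_ge_atTop N] with n hn
  have h2 : 2 < ((n : ℝ) + 1) * (w ^ 2 - θ ^ 2) := by
    rw [← div_lt_iff₀ h1]
    have : (N : ℝ) ≤ n := by exact_mod_cast hn
    linarith
  exact ⟨Real.smoothTransition.one_of_one_le (by linarith), deriv_angCut_eq_zero h2⟩

/-- The cutoff has slope of order n only in a layer of width of order 1/n at ±w, where φ, being
Lipschitz and zero at ±w, is of order 1/n. -/
theorem exists_bound_deriv_angCut_mul {w : ℝ} (hw : 0 < w) {φ : ℝ → ℂ} (hφ : ContDiff ℝ ∞ φ)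
    (h₁ : φ w = 0) (h₂ : φ (-w) = 0) :
    ∃ C, ∀ n, ∀ θ ∈ Ioo (-w) w, ‖((deriv (angCut w n) θ : ℝ) : ℂ) * φ θ‖ ≤ C := by
  obtain ⟨C₀, hC₀, hC⟩ := exists_bound_deriv_smoothTransition
  obtain ⟨D, hD⟩ := isCompact_Icc.exists_bound_of_continuousOn
    (f := deriv φ) (s := Icc (-w) w) (hφ.continuous_deriv (by simp)).continuousOn
  have hlip : ∀ x ∈ Icc (-w) w, ∀ y ∈ Icc (-w) w, ‖φ y - φ x‖ ≤ D * ‖y - x‖ := fun x hx y hy =>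
    (convex_Icc _ _).norm_image_sub_le_of_norm_deriv_le
      (fun z _ => hφ.differentiable (by simp) z) hD hx hy
  have hD0 : 0 ≤ D := (norm_nonneg _).trans (hD 0 ⟨by linarith, hw.le⟩)
  -- Lipschitz bound from the nearer endpoint, with w (w - |θ|) ≤ w² - θ².
  have hb : ∀ θ ∈ Ioo (-w) w, w * ‖φ θ‖ ≤ D * (w ^ 2 - θ ^ 2) := fun θ hθ => by
    have hθ' := Ioo_subset_Icc_self hθ
    rcases le_total 0 θ with h0 | h0
    · have h := hlip w ⟨by linarith, le_rfl⟩ θ hθ'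
      rw [h₁, sub_zero, Real.norm_eq_abs, abs_of_neg (by linarith [hθ.2])] at h
      have h3 : w * (-(θ - w)) ≤ w ^ 2 - θ ^ 2 := by nlinarith [hθ.2]
      nlinarith [mul_le_mul_of_nonneg_left h hw.le, mul_le_mul_of_nonneg_left h3 hD0]
    · have h := hlip (-w) ⟨le_rfl, by linarith⟩ θ hθ'
      rw [h₂, sub_zero, Real.norm_eq_abs, abs_of_pos (by linarith [hθ.1])] at h
      have h3 : w * (θ - -w) ≤ w ^ 2 - θ ^ 2 := by nlinarith [hθ.1]
      nlinarith [mul_le_mul_of_nonneg_left h hw.le, mul_le_mul_of_nonneg_left h3 hD0]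
  refine ⟨4 * C₀ * D, fun n θ hθ => ?_⟩
  have hp : 0 < w ^ 2 - θ ^ 2 := by nlinarith [hθ.1, hθ.2]
  rcases lt_or_ge 2 (((n : ℝ) + 1) * (w ^ 2 - θ ^ 2)) with h | h
  · rw [deriv_angCut_eq_zero h]
    simp
    positivity
  · rw [deriv_angCut, norm_mul, Complex.norm_real, Real.norm_eq_abs, abs_mul, abs_mul, abs_neg,
      abs_mul, abs_two, abs_of_pos (show (0 : ℝ) < n + 1 by positivity)]
    have h1 := hC ((n + 1) * (w ^ 2 - θ ^ 2) - 1)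
    have h2 : |θ| ≤ w := abs_le.2 ⟨hθ.1.le, hθ.2.le⟩
    have h3 := hb θ hθ
    have hn : (0 : ℝ) < n + 1 := by positivity
    calc _ ≤ C₀ * ((n + 1) * (2 * w)) * ‖φ θ‖ := by gcongr
      _ = C₀ * 2 * ((n + 1) * (w * ‖φ θ‖)) := by ring
      _ ≤ C₀ * 2 * ((n + 1) * (D * (w ^ 2 - θ ^ 2))) := by gcongr
      _ = C₀ * 2 * D * ((n + 1) * (w ^ 2 - θ ^ 2)) := by ring
      _ ≤ C₀ * 2 * D * 2 := by gcongr
      _ = 4 * C₀ * D := by ring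

theorem tendsto_sqNorm {w C : ℝ} {F : ℕ → ℝ → ℂ} {G : ℝ → ℂ} (hF : ∀ n, Continuous (F n))
    (hb : ∀ n, ∀ θ ∈ Ioo (-w) w, ‖F n θ‖ ≤ C)
    (hl : ∀ θ ∈ Ioo (-w) w, ∀ᶠ n in atTop, F n θ = G θ) :
    Tendsto (fun n => sqNorm (Ioo (-w) w) (F n)) atTop (nhds (sqNorm (Ioo (-w) w) G)) := by
  refine tendsto_integral_of_dominated_convergence (fun _ => C ^ 2)
    (fun n => ((hF n).norm.pow 2).aestronglyMeasurable) (integrable_const _) (fun n => ?_) ?_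
  · filter_upwards [ae_restrict_mem measurableSet_Ioo] with θ hθ
    rw [Real.norm_eq_abs, abs_of_nonneg (by positivity)]
    exact pow_le_pow_left₀ (norm_nonneg _) (hb n θ hθ) 2
  · filter_upwards [ae_restrict_mem measurableSet_Ioo] with θ hθ
    refine tendsto_const_nhds.congr' ?_
    filter_upwards [hl θ hθ] with n hn
    rw [hn]

theorem sqNorm_pos {w : ℝ} {f : ℝ → ℂ} (hf : Continuous f) {θ : ℝ} (hθ : θ ∈ Ioo (-w) w)
    (h0 : f θ ≠ 0) : 0 < sqNorm (Ioo (-w) w) f := by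
  refine (sqNorm_nonneg _ _).lt_of_ne fun h => h0 ?_
  have hi : IntegrableOn (fun t => ‖f t‖ ^ 2) (Ioo (-w) w) :=
    ((hf.norm.pow 2).continuousOn.integrableOn_Icc).mono_set Ioo_subset_Icc_self
  have h1 := (integral_eq_zero_iff_of_nonneg (fun t => by positivity) hi).1 h.symm
  have h2 := Measure.eqOn_open_of_ae_eq h1 isOpen_Ioo (hf.norm.pow 2).continuousOn
    continuousOn_const
  simpa using h2 hθ

end AngularCutoff

/-! ### The angular equation -/

/-- The angular part of `r ∂_z` on `r ^ (iξ) ψ(θ)`. -/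
noncomputable def angGrad (ξ : ℝ) (ψ : ℝ → ℂ) (θ : ℝ) : ℂ :=
  Complex.I * ξ * ψ θ - Complex.I * deriv ψ θ

/-- The defect of the angular equation. -/
noncomputable def angDefect (s ξ κ : ℝ) (ψ : ℝ → ℂ) (θ : ℝ) : ℂ :=
  -s * angGrad ξ ψ θ + κ * Complex.exp (2 * Complex.I * θ) * angGrad ξ ψ (-θ)
    + (s ^ 2 - 1) * (2 * Complex.I * ξ) * Complex.exp (-ξ * θ)

theorem hasDerivAt_cexp_mul (c : ℂ) (θ : ℝ) :
    HasDerivAt (fun θ : ℝ => Complex.exp (c * θ)) (c * Complex.exp (c * θ)) θ := by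
  have h := (((hasDerivAt_id (θ : ℂ)).const_mul c).cexp).comp_ofReal
  simpa [mul_comm] using h

theorem contDiff_cexp_mul (c : ℂ) : ContDiff ℝ ∞ fun θ : ℝ => Complex.exp (c * θ) :=
  (contDiff_const.mul Complex.ofRealCLM.contDiff).cexp

/-- Up to an arbitrarily small defect, the angular problem has solutions with compact support. -/
theorem exists_angular {w ξ s κ : ℝ} (hw : 0 < w) (hξ : 0 < ξ) (hκ : κ * κ = 1)
    (hchar : s * Real.sinh (2 * w * ξ) = -κ * ξ * Real.sin (2 * w)) {ε : ℝ} (hε : 0 < ε) :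
    ∃ ψ, Cut (Ioo (-w) w) ψ ∧ 0 < sqNorm (Ioo (-w) w) (angGrad ξ ψ) ∧
      sqNorm (Ioo (-w) w) (angDefect s ξ κ ψ) ≤ ε * sqNorm (Ioo (-w) w) (angGrad ξ ψ) := by
  -- The choice that makes φ vanish at `w`.
  set β : ℂ := -(s * Complex.exp (-(2 * w * ξ)) + κ * ξ * Complex.I * Complex.exp (2 * w * Complex.I))
    with hβ
  -- Times r^{iξ}, the three terms are s z^{iξ}, β z̄^{iξ} and iκξ z z̄^{iξ-1}. The second is killed
  -- by ∂_z, so β remains free for a boundary condition.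
  set φ : ℝ → ℂ := fun θ => s * Complex.exp (-ξ * θ) + β * Complex.exp (ξ * θ)
    + κ * ξ * Complex.I * Complex.exp ((2 * Complex.I + ξ) * θ) with hφ
  have hsm : ContDiff ℝ ∞ φ :=
    ((contDiff_const.mul (contDiff_cexp_mul _)).add (contDiff_const.mul (contDiff_cexp_mul _))).add
      (contDiff_const.mul (contDiff_cexp_mul _))
  have hder : ∀ θ, deriv φ θ = s * (-ξ * Complex.exp (-ξ * θ)) + β * (ξ * Complex.exp (ξ * θ))
      + κ * ξ * Complex.I * ((2 * Complex.I + ξ) * Complex.exp ((2 * Complex.I + ξ) * θ)) :=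
    fun θ => ((((hasDerivAt_cexp_mul _ θ).const_mul _).add
      ((hasDerivAt_cexp_mul _ θ).const_mul _)).add ((hasDerivAt_cexp_mul _ θ).const_mul _)).deriv
  have hk : ∀ θ, angGrad ξ φ θ = 2 * Complex.I * ξ *
      (s * Complex.exp (-ξ * θ) + κ * Complex.exp ((2 * Complex.I + ξ) * θ)) := fun θ => by
    rw [angGrad, hder, hφ]
    linear_combination (-2 * κ * ξ * Complex.I * Complex.exp ((2 * Complex.I + ξ) * θ)) * Complex.I_sq
  have hκ' : (κ : ℂ) * κ = 1 := by exact_mod_cast hκ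
  have hdef : ∀ θ, angDefect s ξ κ φ θ = 0 := fun θ => by
    rw [angDefect, hk, hk]
    have e1 : Complex.exp (2 * Complex.I * θ) * Complex.exp (-ξ * ((-θ : ℝ) : ℂ)) =
        Complex.exp ((2 * Complex.I + ξ) * θ) := by
      rw [← Complex.exp_add]; congr 1; push_cast; ring
    have e2 : Complex.exp (2 * Complex.I * θ) * Complex.exp ((2 * Complex.I + ξ) * ((-θ : ℝ) : ℂ)) =
        Complex.exp (-ξ * θ) := by
      rw [← Complex.exp_add]; congr 1; push_cast; ring
    linear_combination (κ * (2 * Complex.I * ξ) * s) * e1 + (κ * κ * (2 * Complex.I * ξ)) * e2 +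
      (2 * Complex.I * ξ * Complex.exp (-ξ * θ)) * hκ'
  have h₁ : φ w = 0 := by
    have e1 : Complex.exp (-(2 * w * ξ)) * Complex.exp (ξ * w) = Complex.exp (-ξ * w) := by
      rw [← Complex.exp_add]; congr 1; ring
    have e2 : Complex.exp (2 * w * Complex.I) * Complex.exp (ξ * w) =
        Complex.exp ((2 * Complex.I + ξ) * w) := by
      rw [← Complex.exp_add]; congr 1; ring
    simp only [hφ, hβ]
    linear_combination (-s : ℂ) * e1 - (κ * ξ * Complex.I) * e2
  -- The difference of the two boundary conditions is the characteristic equation.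
  have h₂ : φ (-w) = 0 := by
    have e1 : Complex.exp (-ξ * ((-w : ℝ) : ℂ)) = Complex.exp (2 * w * ξ) * Complex.exp (-(ξ * w)) := by
      rw [← Complex.exp_add]; congr 1; push_cast; ring
    have e2 : Complex.exp ((2 * Complex.I + ξ) * ((-w : ℝ) : ℂ)) =
        Complex.exp (-(2 * w * Complex.I)) * Complex.exp (-(ξ * w)) := by
      rw [← Complex.exp_add]; congr 1; push_cast; ring
    have e3 : Complex.exp (ξ * ((-w : ℝ) : ℂ)) = Complex.exp (-(ξ * w)) := by
      congr 1; push_cast; ring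
    have hc : (s : ℂ) * Complex.sinh (2 * w * ξ) = -κ * ξ * Complex.sin (2 * w) := by
      exact_mod_cast hchar
    rw [Complex.sinh, Complex.sin] at hc
    simp only [hφ, hβ]
    rw [e1, e2, e3]
    have e4 : Complex.exp (-(2 * w) * Complex.I) = Complex.exp (-(2 * w * Complex.I)) := by
      congr 1; ring
    rw [e4] at hc
    linear_combination (2 * Complex.exp (-(ξ * w))) * hc
  obtain ⟨C, hC⟩ := exists_bound_deriv_angCut_mul hw hsm h₁ h₂
  set ψ : ℕ → ℝ → ℂ := fun n θ => (angCut w n θ : ℂ) * φ θ with hψ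
  have hcut : ∀ n, Cut (Ioo (-w) w) (ψ n) := fun n => cut_angCut_mul hw n hsm
  have hkn : ∀ n θ, angGrad ξ (ψ n) θ = angCut w n θ * angGrad ξ φ θ
      - Complex.I * (((deriv (angCut w n) θ : ℝ) : ℂ) * φ θ) := fun n θ => by
    have hd : HasDerivAt (ψ n) _ θ := (((contDiff_angCut w n).differentiable (by simp)
      θ).hasDerivAt.ofReal_comp).mul (hsm.differentiable (by simp) θ).hasDerivAt
    rw [angGrad, hd.deriv, angGrad]
    ring
  have hcont : ∀ {f : ℝ → ℂ}, ContDiff ℝ ∞ f → Continuous (angGrad ξ f) := fun hf => by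
    unfold angGrad
    exact (continuous_const.mul hf.continuous).sub
      (continuous_const.mul (hf.continuous_deriv (by simp)))
  obtain ⟨K, hK⟩ := isCompact_Icc.exists_bound_of_continuousOn
    (f := angGrad ξ φ) (s := Icc (-w) w) (hcont hsm).continuousOn
  have hbk : ∀ n, ∀ θ ∈ Ioo (-w) w, ‖angGrad ξ (ψ n) θ‖ ≤ K + C := fun n θ hθ => by
    rw [hkn]
    refine (norm_sub_le _ _).trans (add_le_add ?_ ?_)
    · rw [norm_mul, Complex.norm_real, Real.norm_eq_abs,
        abs_of_nonneg (show 0 ≤ angCut w n θ from Real.smoothTransition.nonneg _)]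
      exact (mul_le_of_le_one_left (norm_nonneg _) (Real.smoothTransition.le_one _)).trans
        (hK θ (Ioo_subset_Icc_self hθ))
    · rw [norm_mul, Complex.norm_I, one_mul]
      exact hC n θ hθ
  have hlk : ∀ θ ∈ Ioo (-w) w, ∀ᶠ n in atTop, angGrad ξ (ψ n) θ = angGrad ξ φ θ := fun θ hθ => by
    filter_upwards [eventually_angCut hθ] with n hn
    rw [hkn, hn.1, hn.2]
    simp
  have hneg : ∀ θ ∈ Ioo (-w) w, -θ ∈ Ioo (-w) w := fun θ hθ =>
    ⟨by linarith [hθ.2], by linarith [hθ.1]⟩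
  have t1 := tendsto_sqNorm (fun n => hcont (hcut n).1) hbk hlk
  obtain ⟨E, hE⟩ := isCompact_Icc.exists_bound_of_continuousOn
    (f := fun θ : ℝ => Complex.exp (-ξ * θ)) (s := Icc (-w) w) (contDiff_cexp_mul _).continuous.continuousOn
  have hexp : ∀ θ : ℝ, ‖Complex.exp (2 * Complex.I * θ)‖ = 1 := fun θ => by
    rw [show 2 * Complex.I * (θ : ℂ) = ((2 * θ : ℝ) : ℂ) * Complex.I by push_cast; ring]
    exact Complex.norm_exp_ofReal_mul_I _
  -- The bound on the cutoff derivative times φ dominates, and at each interior angle the defect is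
  -- eventually that of φ, namely 0. The factor ε in the conclusion comes from this limit.
  have t2 : Tendsto (fun n => sqNorm (Ioo (-w) w) (angDefect s ξ κ (ψ n))) atTop
      (nhds (sqNorm (Ioo (-w) w) fun _ => 0)) := by
    refine tendsto_sqNorm (C := |s| * (K + C) + |κ| * (K + C) + ‖((s : ℂ) ^ 2 - 1) * (2 * Complex.I * ξ)‖ * E)
      (fun n => ?_) (fun n θ hθ => ?_) fun θ hθ => ?_
    · unfold angDefect
      exact ((continuous_const.mul (hcont (hcut n).1)).add
        ((continuous_const.mul (contDiff_cexp_mul _).continuous).mul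
          ((hcont (hcut n).1).comp continuous_neg))).add
        (continuous_const.mul (contDiff_cexp_mul _).continuous)
    · rw [angDefect]
      refine (norm_add₃_le).trans (add_le_add (add_le_add ?_ ?_) ?_)
      · rw [norm_mul, norm_neg, Complex.norm_real, Real.norm_eq_abs]
        exact mul_le_mul_of_nonneg_left (hbk n θ hθ) (abs_nonneg _)
      · rw [norm_mul, norm_mul, hexp, Complex.norm_real, Real.norm_eq_abs, mul_one]
        exact mul_le_mul_of_nonneg_left (hbk n _ (hneg θ hθ)) (abs_nonneg _)
      · rw [norm_mul]
        exact mul_le_mul_of_nonneg_left (hE θ (Ioo_subset_Icc_self hθ)) (norm_nonneg _)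
    · filter_upwards [hlk θ hθ, hlk (-θ) (hneg θ hθ)] with n hn hn'
      rw [← hdef θ, angDefect, angDefect, hn, hn']
  have hz : sqNorm (Ioo (-w) w) (fun _ => (0 : ℂ)) = 0 := by simp [sqNorm]
  have hpos : 0 < sqNorm (Ioo (-w) w) (angGrad ξ φ) := by
    have hI : 2 * Complex.I * (ξ : ℂ) ≠ 0 := by simp [hξ.ne']
    -- A zero at 0 forces s = -κ. A second zero at w/2 would equate e^{-ξw/2} with e^{ξw/2} in
    -- modulus.
    by_cases h0 : angGrad ξ φ 0 = 0
    · refine sqNorm_pos (hcont hsm) (θ := w / 2) ⟨by linarith, by linarith⟩ fun h1 => ?_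
      rw [hk, mul_eq_zero, or_iff_right hI] at h0 h1
      have h0' : (s : ℂ) = -κ := by
        simp at h0
        linear_combination h0
      have h2 : (s : ℂ) * Complex.exp (-ξ * ((w / 2 : ℝ) : ℂ)) =
          s * Complex.exp ((2 * Complex.I + ξ) * ((w / 2 : ℝ) : ℂ)) := by
        linear_combination h1 - Complex.exp ((2 * Complex.I + ξ) * ((w / 2 : ℝ) : ℂ)) * h0'
      have hs : (s : ℂ) ≠ 0 := by
        rw [h0', neg_ne_zero]
        rintro h
        rw [h] at hκ'
        simp at hκ'
      have h3 := congrArg norm (mul_left_cancel₀ hs h2)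
      rw [Complex.norm_exp, Complex.norm_exp] at h3
      have h4 := Real.exp_injective h3
      simp at h4
      nlinarith
    · exact sqNorm_pos (hcont hsm) ⟨by linarith, hw⟩ h0
  rw [hz] at t2
  set A := sqNorm (Ioo (-w) w) (angGrad ξ φ)
  have hev := (t1.eventually (lt_mem_nhds (half_lt_self hpos))).and
    (t2.eventually (gt_mem_nhds (show 0 < ε * (A / 2) by positivity)))
  obtain ⟨n, h5, h6⟩ := hev.exists
  exact ⟨ψ n, hcut n, (half_pos hpos).trans h5,
    h6.le.trans (mul_le_mul_of_nonneg_left h5.le hε.le)⟩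

end Cosserat

/-! ### Geometry of the edge and plane test fields -/

namespace Cosserat

open scoped ContDiff
open Set Filter

theorem norm_planar (x : R3) : ‖planar x‖ = √(x 0 ^ 2 + x 1 ^ 2) := by
  rw [planar_apply, Complex.norm_def, Complex.normSq_apply]
  simp only [pow_two]

section Geometry

variable {Ω : Opens R3} {w R : ℝ} {T : Set ℝ} {χ : ℝ → ℂ}

theorem mem_cylinder_of_log (hT : T ⊆ Iio 0) (hT' : T ⊆ Iic (Real.log (2 * R))) (hR : 0 < R)
    (hχ : tsupport χ ⊆ Icc (-R) R) {x : R3} (h1 : x 2 ∈ tsupport χ)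
    (h2 : Real.log ‖planar x‖ ∈ T) : planar x ≠ 0 ∧ x ∈ cylinder (2 * R) := by
  have h0 : planar x ≠ 0 := fun h0 => by
    have := hT h2
    simp [h0] at this
  refine ⟨h0, ?_, abs_le.2 ⟨by linarith [(hχ h1).1], by linarith [(hχ h1).2]⟩⟩
  rw [← norm_planar]
  exact (Real.log_le_log_iff (by positivity) (by positivity)).1 (hT' h2)

theorem mem_of_mem_carrier
    (hΩ : (Ω : Set R3) ∩ cylinder (2 * R) = cylinder (2 * R) ∩ wedge (2 * w))
    (hT : T ⊆ Iio 0) (hT' : T ⊆ Iic (Real.log (2 * R))) (hR : 0 < R) (hχ : Cut univ χ)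
    (hχR : tsupport χ ⊆ Icc (-R) R) {b h : ℝ → ℂ} (hb : Cut T b) (hw : w < Real.pi)
    (hh : Cut (Ioo (-w) w) h) {x : R3} (hx : x ∈ Cutoff.carrier χ b h) : x ∈ Ω := by
  have hh' : Cut (Ioo (-Real.pi) Real.pi) h := hh.mono (Ioo_subset_Ioo (by linarith) hw.le)
  obtain ⟨-, h1, h2, h3⟩ := (hχ.cutoff (hb.mono hT) hh').of_mem_carrier hx
  obtain ⟨h0, hc⟩ := mem_cylinder_of_log hT hT' hR hχR h1 (hb.subset h2)
  have : x ∈ cylinder (2 * R) ∩ wedge (2 * w) := by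
    refine ⟨hc, ?_, ?_⟩
    · rwa [← planar_apply]
    · rw [← planar_apply]
      rw [mul_div_cancel_left₀ w two_ne_zero]
      exact abs_lt.2 (hh.subset h3)
  rw [← hΩ] at this
  exact this.1

/-- In the shell around the edge Ω coincides with the wedge, so every test field vanishes beyond the
faces there. This confines the estimates to the sector. -/
theorem notMem_of_notMem_sector
    (hΩ : (Ω : Set R3) ∩ cylinder (2 * R) = cylinder (2 * R) ∩ wedge (2 * w))
    (hT : T ⊆ Iio 0) (hT' : T ⊆ Iic (Real.log (2 * R))) (hR : 0 < R)
    (hχR : tsupport χ ⊆ Icc (-R) R) {x : R3} (h1 : x 2 ∈ tsupport χ)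
    (h2 : Real.log ‖planar x‖ ∈ T) (hx : x ∉ sector (Ioo (-w) w)) : x ∉ Ω := by
  intro hΩx
  have : x ∈ (Ω : Set R3) ∩ cylinder (2 * R) :=
    ⟨hΩx, (mem_cylinder_of_log hT hT' hR hχR h1 h2).2⟩
  rw [hΩ] at this
  have h3 := this.2.2
  rw [← planar_apply, mul_div_cancel_left₀ w two_ne_zero] at h3
  exact hx (abs_lt.1 h3)

end Geometry

/-- The plane vector field with components `pol χ b h₀` and `pol χ b h₁`. -/
noncomputable def planeField (χ b h₀ h₁ : ℝ → ℂ) (x : R3) : C3 :=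
  WithLp.toLp 2 ![pol χ b h₀ x, pol χ b h₁ x, 0]

theorem contDiff_planeField {χ b h₀ h₁ : ℝ → ℂ} (H₀ : Cutoff χ b h₀) (H₁ : Cutoff χ b h₁) :
    ContDiff ℝ ∞ (planeField χ b h₀ h₁) := by
  refine (PiLp.continuousLinearEquiv 2 ℝ fun _ : Fin 3 => ℂ).symm.contDiff.comp
    (contDiff_pi.2 fun i => ?_)
  fin_cases i
  · exact H₀.contDiff
  · exact H₁.contDiff
  · exact contDiff_const

theorem support_planeField {χ b h₀ h₁ : ℝ → ℂ} (H₀ : Cutoff χ b h₀) (H₁ : Cutoff χ b h₁) :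
    Function.support (planeField χ b h₀ h₁) ⊆ Cutoff.carrier χ b h₀ ∪ Cutoff.carrier χ b h₁ := by
  intro x hx
  by_contra h
  rw [mem_union, not_or] at h
  refine hx ?_
  have e₀ : pol χ b h₀ x = 0 := by
    by_contra h'
    exact h.1 (H₀.support_subset_carrier h')
  have e₁ : pol χ b h₁ x = 0 := by
    by_contra h'
    exact h.2 (H₁.support_subset_carrier h')
  ext i
  fin_cases i <;> simp [planeField, e₀, e₁]

/-- `planeField` as a test field. -/
noncomputable def planeTest (Ω : Opens R3) {χ b h₀ h₁ : ℝ → ℂ} (H₀ : Cutoff χ b h₀)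
    (H₁ : Cutoff χ b h₁) (h : Cutoff.carrier χ b h₀ ∪ Cutoff.carrier χ b h₁ ⊆ Ω) : TestField Ω :=
  have hc := H₀.isCompact_carrier.union H₁.isCompact_carrier
  { toFun := planeField χ b h₀ h₁
    contDiff' := contDiff_planeField H₀ H₁
    hasCompactSupport' := HasCompactSupport.of_support_subset_isCompact hc (support_planeField H₀ H₁)
    tsupport_subset' := (closure_minimal (support_planeField H₀ H₁) hc.isClosed).trans h }

theorem comp_planeTest (Ω : Opens R3) {χ b h₀ h₁ : ℝ → ℂ} (H₀ : Cutoff χ b h₀)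
    (H₁ : Cutoff χ b h₁) (h : Cutoff.carrier χ b h₀ ∪ Cutoff.carrier χ b h₁ ⊆ Ω) :
    comp (planeTest Ω H₀ H₁ h) 0 = pol χ b h₀ ∧ comp (planeTest Ω H₀ H₁ h) 1 = pol χ b h₁ ∧
      comp (planeTest Ω H₀ H₁ h) 2 = 0 :=
  ⟨rfl, rfl, rfl⟩

theorem pd_pol_eq_zero {T : Set ℝ} {χ b h : ℝ → ℂ} (hχ : Cut univ χ) (hT : T ⊆ Iio 0)
    (hb : Cut T b) (hh : Cut (Ioo (-Real.pi) Real.pi) h) {x : R3} (hx : Real.log ‖planar x‖ ∉ T)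
    (i : Fin 3) : pd i (pol χ b h) x = 0 := by
  have H := hχ.cutoff (hb.mono hT) hh
  have h1 : x ∉ tsupport (fderiv ℝ (pol χ b h)) := fun h' => hx
    (hb.subset (H.of_mem_carrier (H.tsupport_subset_carrier (tsupport_fderiv_subset ℝ h'))).2.2.1)
  rw [pd, image_eq_zero_of_notMem_tsupport h1]
  simp

theorem norm_phase {ι : ℝ} (hι : ι * ι = 1) (θ : ℝ) : ‖phase ι θ‖ = 1 := by
  have h : phase ι θ = ⟨Real.cos θ, -(ι * Real.sin θ)⟩ := by
    apply Complex.ext <;> simp [phase, -Complex.ofReal_cos, -Complex.ofReal_sin]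
  rw [h, Complex.norm_def, Complex.normSq_mk, Real.sqrt_eq_one]
  linear_combination Real.sin_sq_add_cos_sq θ + (Real.sin θ) ^ 2 * hι

theorem phase_neg_one (θ : ℝ) :
    phase (-1) θ = phase 1 θ * Complex.exp (2 * Complex.I * θ) := by
  have e1 : phase (-1) θ = Complex.exp (θ * Complex.I) := by
    rw [Complex.exp_mul_I, phase]; push_cast; ring
  have e2 : phase 1 θ = Complex.exp (-θ * Complex.I) := by
    rw [Complex.exp_mul_I, phase, Complex.cos_neg, Complex.sin_neg]; push_cast; ring
  rw [e1, e2, ← Complex.exp_add]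
  congr 1
  ring

theorem sqNorm_congr {I : Set ℝ} (hI : MeasurableSet I) {f g : ℝ → ℂ}
    (h : ∀ θ ∈ I, ‖f θ‖ = ‖g θ‖) : sqNorm I f = sqNorm I g :=
  setIntegral_congr_fun hI fun θ hθ => by simp only [h θ hθ]

theorem sqNorm_comp_neg (w : ℝ) (f : ℝ → ℂ) :
    sqNorm (Ioo (-w) w) (fun θ => f (-θ)) = sqNorm (Ioo (-w) w) f := by
  rw [sqNorm, sqNorm, ← integral_indicator measurableSet_Ioo, ← integral_indicator measurableSet_Ioo,
    ← integral_neg_eq_self]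
  congr 1 with θ
  have : -θ ∈ Ioo (-w) w ↔ θ ∈ Ioo (-w) w := by
    simp only [mem_Ioo]
    constructor <;> rintro ⟨h1, h2⟩ <;> constructor <;> linarith
  by_cases h : θ ∈ Ioo (-w) w
  · rw [indicator_of_mem h, indicator_of_mem (this.2 h), neg_neg]
  · rw [indicator_of_notMem h, indicator_of_notMem fun h' => h (this.1 h')]

/-- A function with compact support in `(-π, π)` which coincides with an exponential on `(-w, w)`. -/
theorem exists_cut_exp {w : ℝ} (hw : 0 < w) (hw' : w < Real.pi) (c d : ℂ) :
    ∃ h, Cut (Ioo (-Real.pi) Real.pi) h ∧ ∀ θ ∈ Ioo (-w) w,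
      h θ = d * Complex.exp (c * θ) ∧ deriv h θ = c * h θ := by
  let η : ContDiffBump (0 : ℝ) := ⟨w, (w + Real.pi) / 2, hw, by linarith⟩
  have h1 : ∀ θ ∈ Ioo (-w) w, η θ = 1 := fun θ hθ => η.one_of_mem_closedBall (by
    rw [mem_closedBall_zero_iff, Real.norm_eq_abs]
    exact abs_le.2 ⟨hθ.1.le, hθ.2.le⟩)
  have hsub : tsupport (fun θ : ℝ => ((η θ : ℝ) : ℂ)) ⊆ Ioo (-Real.pi) Real.pi := by
    have : tsupport (fun θ : ℝ => ((η θ : ℝ) : ℂ)) ⊆ tsupport η :=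
      closure_mono fun θ hθ h0 => hθ (by simp [h0])
    refine this.trans ?_
    rw [η.tsupport_eq, Real.closedBall_eq_Icc]
    intro θ hθ
    have h2 : η.rOut = (w + Real.pi) / 2 := rfl
    rw [h2] at hθ
    exact ⟨by linarith [hθ.1], by linarith [hθ.2]⟩
  have hη : Cut (Ioo (-Real.pi) Real.pi) fun θ => ((η θ : ℝ) : ℂ) :=
    ⟨Complex.ofRealCLM.contDiff.comp η.contDiff,
      η.hasCompactSupport.comp_left (g := fun r : ℝ => (r : ℂ)) Complex.ofReal_zero, hsub⟩
  refine ⟨_, hη.mul (contDiff_const.mul (contDiff_cexp_mul c)) (g := fun θ => d * Complex.exp (c * θ)),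
    fun θ hθ => ?_⟩
  have h2 : (fun θ => ((η θ : ℝ) : ℂ) * (d * Complex.exp (c * θ))) =ᶠ[nhds θ]
      fun θ => d * Complex.exp (c * θ) := by
    filter_upwards [isOpen_Ioo.mem_nhds hθ] with t ht
    simp [h1 t ht]
  have h3 := ((hasDerivAt_cexp_mul c θ).const_mul d).deriv
  refine ⟨h2.eq_of_nhds, ?_⟩
  rw [h2.deriv_eq, h3, h2.eq_of_nhds]
  ring

end Cosserat

/-! ### Energy estimates for the approximate solutions -/

namespace Cosserat

open scoped ContDiff
open Set Filter

theorem pd_cc_eq_zero {Ω : Opens R3} {x : R3} (hx : x ∉ Ω) (v : TestField Ω) (ε : ℝ) (i : Fin 3) :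
    pd i (cc ε v) x = 0 := by
  rw [pd_cc, pd_comp_eq_zero v 0 i hx, pd_comp_eq_zero v 1 i hx]
  simp

/-- The axial derivative of `pol`, as a weighted function. -/
theorem pd_pol_axial_eq_wpol {T : Set ℝ} (hT : T ⊆ Iio 0) {χ b h : ℝ → ℂ} (hχ : Cut univ χ)
    (hb : Cut T b) (hh : Cut (Ioo (-Real.pi) Real.pi) h) :
    pd 2 (pol χ b h) = wpol (deriv χ) (fun t => b t * Real.exp t) h := by
  rw [pd_pol_axial hχ (hb.mono hT) hh]
  ext x
  -- An axial derivative carries no 1/r; in the scale-invariant weight it therefore counts with an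
  -- extra factor r = e^t.
  have : ∀ t : ℝ, ((Real.exp t : ℝ) : ℂ) * expNeg t = 1 := fun t => by
    rw [expNeg, ← Complex.ofReal_mul, ← Real.exp_add]
    simp
  simp only [wpol, pol, mul_assoc, this, mul_one]

theorem sqrt_mul_three_right {x a n : ℝ} (hx : 0 ≤ x) (hn : 0 ≤ n) :
    √(x * a * n) = √(x * n) * √a := by
  rw [← Real.sqrt_mul (mul_nonneg hx hn)]
  congr 1
  ring

theorem contDiff_ofReal_exp : ContDiff ℝ ∞ fun t : ℝ => ((Real.exp t : ℝ) : ℂ) :=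
  Complex.ofRealCLM.contDiff.comp Real.contDiff_exp

section Estimate

variable {w ξ s κ : ℝ} {ψ : ℝ → ℂ}

theorem deriv_reflect (hψ : Cut (Ioo (-w) w) ψ) (θ : ℝ) :
    deriv (fun θ => (κ : ℂ) * ψ (-θ)) θ = -(κ * deriv ψ (-θ)) := by
  have h := ((hψ.smooth.differentiable (by simp) (-θ)).hasDerivAt.scomp θ (hasDerivAt_neg θ)).const_mul
    (κ : ℂ)
  have h' : deriv (fun θ => (κ : ℂ) * ψ (-θ)) θ = _ := h.deriv
  rw [h']
  simp

/-- In the sector, the defect of the first stress equation is that of the angular equation. -/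
theorem norm_defect (hψ : Cut (Ioo (-w) w) ψ) {h₃ : ℝ → ℂ} {θ : ℝ}
    (h : h₃ θ = (s ^ 2 - 1) * Complex.exp (-ξ * θ) ∧ deriv h₃ θ = -ξ * h₃ θ) :
    ‖(Complex.I * ξ * (h₃ θ - s * ψ θ) - (1 : ℝ) * Complex.I * (deriv h₃ θ - s * deriv ψ θ)) * phase 1 θ
      + (Complex.I * ξ * (κ * ψ (-θ)) + (1 : ℝ) * Complex.I * deriv (fun θ => (κ : ℂ) * ψ (-θ)) θ)
        * phase (-1) θ‖ = ‖angDefect s ξ κ ψ θ‖ := by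
  trans ‖angDefect s ξ κ ψ θ * phase 1 θ‖
  swap
  · rw [norm_mul, norm_phase (by norm_num), mul_one]
  rw [deriv_reflect hψ, h.2, h.1, phase_neg_one, angDefect, angGrad, angGrad]
  congr 1
  push_cast
  ring

/-- In the sector, the defect of the second stress equation is that of the angular equation. -/
theorem norm_defect_reflect (hκ : κ * κ = 1) (hψ : Cut (Ioo (-w) w) ψ) {h₃ : ℝ → ℂ} {θ : ℝ}
    (h : h₃ θ = κ * (s ^ 2 - 1) * Complex.exp (ξ * θ) ∧ deriv h₃ θ = ξ * h₃ θ) :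
    ‖(Complex.I * ξ * (h₃ θ - s * (κ * ψ (-θ)))
        - (-1 : ℝ) * Complex.I * (deriv h₃ θ - s * deriv (fun θ => (κ : ℂ) * ψ (-θ)) θ)) * phase (-1) θ
      + (Complex.I * ξ * ψ θ + (-1 : ℝ) * Complex.I * deriv ψ θ) * phase 1 θ‖ =
      ‖angDefect s ξ κ ψ (-θ)‖ := by
  have hκ' : (κ : ℂ) * κ = 1 := by exact_mod_cast hκ
  have hn : ‖(κ : ℂ) * phase (-1) θ‖ = 1 := by
    rw [norm_mul, norm_phase (by norm_num), mul_one, Complex.norm_real, Real.norm_eq_abs]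
    nlinarith [abs_mul_abs_self κ, abs_nonneg κ]
  have e1 : Complex.exp (-ξ * ((-θ : ℝ) : ℂ)) = Complex.exp (ξ * θ) := by
    congr 1; push_cast; ring
  have e2 : phase 1 θ = phase (-1) θ * Complex.exp (2 * Complex.I * ((-θ : ℝ) : ℂ)) := by
    rw [phase_neg_one, mul_assoc, ← Complex.exp_add]
    push_cast
    ring_nf
    simp
  trans ‖angDefect s ξ κ ψ (-θ) * (κ * phase (-1) θ)‖
  swap
  · rw [norm_mul, hn, mul_one]
  rw [deriv_reflect hψ, h.2, h.1, e2, angDefect, angGrad, angGrad, neg_neg, e1]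
  generalize Complex.exp (2 * Complex.I * ((-θ : ℝ) : ℂ)) = E
  congr 1
  push_cast
  linear_combination (-phase (-1) θ * E *
    (Complex.I * ξ * ψ θ - Complex.I * deriv ψ θ)) * hκ'

/-- A field whose radial factor is a modulated oscillation and whose angular factor is an
approximate solution of the angular equation. -/
theorem exists_field_estimate {Ω : Opens R3} {R σ : ℝ} (hw : 0 < w) (hw' : w < Real.pi)
    (hR : 0 < R) (hΩ : (Ω : Set R3) ∩ cylinder (2 * R) = cylinder (2 * R) ∩ wedge (2 * w))
    (hκ : κ * κ = 1) (hs : s = 2 * σ - 1) {χ : ℝ → ℂ} (hχ : Cut univ χ)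
    (hχR : tsupport χ ⊆ Icc (-R) R) (hψ : Cut (Ioo (-w) w) ψ) :
    ∃ C, 0 ≤ C ∧ ∀ (T : Set ℝ) (a b : ℝ → ℂ), T ⊆ Iio 0 → T ⊆ Iic (Real.log (2 * R)) →
      Cut T a → Cut T b → (∀ t, deriv b t = a t + Complex.I * ξ * b t) →
      ∃ u : TestField Ω,
        (∀ x k j, Real.log ‖planar x‖ ∉ T → pd j (comp u k) x = 0) ∧
        sqNorm univ χ * sqNorm univ b * sqNorm (Ioo (-w) w) (angGrad ξ ψ) ≤
          32 * ‖(u : H10 Ω)‖ ^ 2 + C * sqNorm univ a ∧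
        ∀ v : TestField Ω, ‖L Ω σ u v‖ ≤
          (4 * √(sqNorm univ χ * sqNorm univ b * sqNorm (Ioo (-w) w) (angDefect s ξ κ ψ))
            + C * (√(sqNorm univ a) + √(sqNorm univ fun t => b t * Real.exp t))) *
              ‖(v : H10 Ω)‖ := by
  set I := Ioo (-w) w with hIdef
  have hI : MeasurableSet I := measurableSet_Ioo
  have hIπ : I ⊆ Ioo (-Real.pi) Real.pi := Ioo_subset_Ioo (by linarith) hw'.le
  have hψr : Cut I fun θ => (κ : ℂ) * ψ (-θ) := hψ.comp_neg.const_mul κ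
  have hψπ := hψ.mono hIπ
  have hψrπ := hψr.mono hIπ
  -- The angular parts of the potentials (s² - 1) z^{iξ} and κ (s² - 1) z̄^{iξ} of the two stresses.
  -- They are cut off only outside the sector.
  obtain ⟨g, hg, hgI⟩ := exists_cut_exp hw hw' (-ξ) ((s : ℂ) ^ 2 - 1)
  obtain ⟨g', hg', hgI'⟩ := exists_cut_exp hw hw' ξ (κ * ((s : ℂ) ^ 2 - 1))
  set X := sqNorm univ χ with hX
  have hX0 : 0 ≤ X := sqNorm_nonneg _ _
  set X' := sqNorm univ (deriv χ) with hX'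
  have hX0' : 0 ≤ X' := sqNorm_nonneg _ _
  set k₁ := sqNorm I fun θ => (g θ - s * ψ θ) * phase 1 θ + (κ * ψ (-θ)) * phase (-1) θ
  set k₂ := sqNorm I fun θ => g θ * phase (-1) θ
  set k₁' := sqNorm I fun θ => (g' θ - s * (κ * ψ (-θ))) * phase (-1) θ + ψ θ * phase 1 θ
  set k₂' := sqNorm I fun θ => g' θ * phase 1 θ
  set n := sqNorm I ψ
  set n' := sqNorm I fun θ => (κ : ℂ) * ψ (-θ)
  set m := sqNorm I fun θ => ψ θ * phase 1 θ
  have hk₁ : 0 ≤ k₁ := sqNorm_nonneg _ _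
  have hk₂ : 0 ≤ k₂ := sqNorm_nonneg _ _
  have hk₁' : 0 ≤ k₁' := sqNorm_nonneg _ _
  have hk₂' : 0 ≤ k₂' := sqNorm_nonneg _ _
  have hn : 0 ≤ n := sqNorm_nonneg _ _
  have hn' : 0 ≤ n' := sqNorm_nonneg _ _
  have hm : 0 ≤ m := sqNorm_nonneg _ _
  set C₁ := 2 * (√(X * k₁) + √(X * k₂)) + 2 * (√(X * k₁') + √(X * k₂')) with hC₁
  set C₂ := (|σ| / 2 + 1) * 2 * (√(X' * n) + √(X' * n')) with hC₂
  have hC₁0 : 0 ≤ C₁ := by positivity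
  have hC₂0 : 0 ≤ C₂ := by positivity
  refine ⟨C₁ + C₂ + 2 * (X * m), by positivity, fun T a b hT hT' ha hb hd => ?_⟩
  set α := sqNorm univ a
  set β := sqNorm univ fun t => b t * Real.exp t
  have hα : 0 ≤ α := sqNorm_nonneg _ _
  -- Angular factors of u₁ = (u₊ + u₋)/2 and u₂ = (u₊ - u₋)/(2i).
  have c₀ : Cut I fun θ => 2⁻¹ * (ψ θ + κ * ψ (-θ)) := (hψ.add hψr).const_mul _
  have c₁ : Cut I fun θ => -(Complex.I * 2⁻¹) * (ψ θ - κ * ψ (-θ)) := (hψ.sub hψr).const_mul _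
  have H₀ := hχ.cutoff (hb.mono hT) (c₀.mono hIπ)
  have H₁ := hχ.cutoff (hb.mono hT) (c₁.mono hIπ)
  have hsub := union_subset
    (fun x hx => mem_of_mem_carrier hΩ hT hT' hR hχ hχR hb hw' c₀ hx)
    (fun x hx => mem_of_mem_carrier hΩ hT hT' hR hχ hχR hb hw' c₁ hx)
  obtain ⟨u0, u1, u2⟩ := comp_planeTest Ω H₀ H₁ hsub
  set u := planeTest Ω H₀ H₁ hsub
  have hp : cc 1 u = pol χ b ψ := by
    ext x
    simp only [cc, u0, u1, pol]
    push_cast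
    linear_combination (-χ (x 2) * b (Real.log ‖planar x‖) * 2⁻¹ *
      (ψ (planar x).arg - κ * ψ (-(planar x).arg))) * Complex.I_sq
  have hmm : cc (-1) u = pol χ b fun θ => κ * ψ (-θ) := by
    ext x
    simp only [cc, u0, u1, pol]
    push_cast
    linear_combination (χ (x 2) * b (Real.log ‖planar x‖) * 2⁻¹ *
      (ψ (planar x).arg - κ * ψ (-(planar x).arg))) * Complex.I_sq
  refine ⟨u, fun x k j hx => ?_, ?_, fun v => ?_⟩
  · fin_cases k
    · change pd j (comp u 0) x = 0
      rw [u0]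
      exact pd_pol_eq_zero hχ hT hb (c₀.mono hIπ) hx j
    · change pd j (comp u 1) x = 0
      rw [u1]
      exact pd_pol_eq_zero hχ hT hb (c₁.mono hIπ) hx j
    · change pd j (comp u 2) x = 0
      rw [u2]
      simp [pd]
  · have b1 := (Real.sqrt_le_left (by positivity)).1
      (sqrt_integral_dz_cc_le (ι := 1) (ε := 1) (by simp) (by simp) u)
    rw [hp] at b1
    have cg : Cut (Ioo (-Real.pi) Real.pi) fun θ =>
        (Complex.I * ξ * ψ θ - (1 : ℝ) * Complex.I * deriv ψ θ) * phase 1 θ := cut_angular hψπ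
    have cp : Cut (Ioo (-Real.pi) Real.pi) fun θ => ψ θ * phase 1 θ := hψπ.mul (contDiff_phase 1)
    have e1 := integral_wpol_sq (χ := χ) (b := b) (h := fun θ =>
        (Complex.I * ξ * ψ θ - (1 : ℝ) * Complex.I * deriv ψ θ) * phase 1 θ) hI hIπ
    have e2 := integral_wpol_sq (χ := χ) (b := a) (h := fun θ => ψ θ * phase 1 θ) hI hIπ
    have e3 : (sqNorm I fun θ => (Complex.I * ξ * ψ θ - (1 : ℝ) * Complex.I * deriv ψ θ) * phase 1 θ)
        = sqNorm I (angGrad ξ ψ) := sqNorm_congr hI fun θ _ => by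
      rw [norm_mul, norm_phase (by norm_num), angGrad]
      simp
    rw [e3] at e1
    have i2 := (memLp_wpol hχ (ha.mono hT) cp).integrable_norm_pow (by simp)
    have B : Bump (pol χ b ψ) :=
      ⟨(hχ.cutoff (hb.mono hT) hψπ).contDiff, (hχ.cutoff (hb.mono hT) hψπ).hasCompactSupport⟩
    have i3 := (B.dz 1).memLp.integrable_norm_pow (by simp)
    -- The gradient term with `b` is 2 ∂_z u₊ minus the term with `a`, whence 8 and 2. As ∂_z u₊ has
    -- norm at most 2‖u‖, the constant 32 results.
    have key : ∫ x in sector I, ‖wpol χ b (fun θ =>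
        (Complex.I * ξ * ψ θ - (1 : ℝ) * Complex.I * deriv ψ θ) * phase 1 θ) x‖ ^ 2 ≤
        8 * (∫ x, ‖dz 1 (pol χ b ψ) x‖ ^ 2)
          + 2 * ∫ x in sector I, ‖wpol χ a (fun θ => ψ θ * phase 1 θ) x‖ ^ 2 := by
      calc _ ≤ ∫ x in sector I, (8 * ‖dz 1 (pol χ b ψ) x‖ ^ 2
            + 2 * ‖wpol χ a (fun θ => ψ θ * phase 1 θ) x‖ ^ 2) := by
            refine integral_mono_of_nonneg (Eventually.of_forall fun x => by positivity)
              ((i3.const_mul 8).add (i2.const_mul 2)).integrableOn (Eventually.of_forall fun x => ?_)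
            have h := dz_pol_of_deriv hT (ι := 1) (by norm_num) hχ hb hd hψπ x
            have h' := norm_add_sq_le_two (2 * dz 1 (pol χ b ψ) x)
              (-wpol χ a (fun θ => ψ θ * phase 1 θ) x)
            have h'' : 2 * dz 1 (pol χ b ψ) x + -wpol χ a (fun θ => ψ θ * phase 1 θ) x =
                wpol χ b (fun θ =>
                  (Complex.I * ξ * ψ θ - (1 : ℝ) * Complex.I * deriv ψ θ) * phase 1 θ) x := by
              rw [h]; ring
            rw [h'', norm_mul, norm_neg, Complex.norm_two, mul_pow] at h'
            change _ ≤ 8 * ‖dz 1 (pol χ b ψ) x‖ ^ 2 + _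
            linarith
        _ = 8 * (∫ x in sector I, ‖dz 1 (pol χ b ψ) x‖ ^ 2)
          + 2 * ∫ x in sector I, ‖wpol χ a (fun θ => ψ θ * phase 1 θ) x‖ ^ 2 := by
            rw [integral_add (i3.const_mul 8).integrableOn (i2.const_mul 2).integrableOn,
              integral_const_mul, integral_const_mul]
        _ ≤ _ := by
            gcongr
            · exact Eventually.of_forall fun x => by positivity
            · exact Measure.restrict_le_self
    rw [e1, e2] at key
    have : 0 ≤ (C₁ + C₂) * α := by positivity
    linarith
  · have hv : ∀ ε i x, x 2 ∈ tsupport χ → Real.log ‖planar x‖ ∈ T → x ∉ sector I →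
        pd i (cc ε v) x = 0 := fun ε i x h1 h2 h3 =>
      pd_cc_eq_zero (notMem_of_notMem_sector hΩ hT hT' hR hχR h1 h2 h3) v ε i
    have hv2 : ∀ ι x, x 2 ∈ tsupport χ → Real.log ‖planar x‖ ∈ T → x ∉ sector I →
        dz ι (comp v 2) x = 0 := fun ι x h1 h2 h3 => by
      have h4 := notMem_of_notMem_sector hΩ hT hT' hR hχR h1 h2 h3
      rw [dz, pd_comp_eq_zero v 2 0 h4, pd_comp_eq_zero v 2 1 h4]
      simp
    have s1 := norm_integral_stress_le (s := s) (ι := 1) (c := Complex.I * ξ) hI hIπ hT (by norm_num)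
      hχ hb ha hd hψπ hψrπ hg (fun θ hθ => by rw [(hgI θ hθ).2]; push_cast; ring) (bump_cc (-1) v)
      (fun x h1 h2 h3 i => hv _ i x h1 h2 h3) rfl rfl
    rw [sqNorm_congr hI fun θ hθ => norm_defect (κ := κ) hψ (hgI θ hθ)] at s1
    -- The second equation is the reflection θ ↦ -θ of the first, so its defect has the same norm.
    have s2 := norm_integral_stress_le (s := s) (ι := -1) (c := Complex.I * ξ) hI hIπ hT (by norm_num)
      hχ hb ha hd hψrπ hψπ hg' (fun θ hθ => by rw [(hgI' θ hθ).2]; push_cast; ring) (bump_cc 1 v)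
      (fun x h1 h2 h3 i => hv _ i x h1 h2 h3) rfl rfl
    rw [neg_neg, sqNorm_congr hI fun θ hθ => norm_defect_reflect hκ hψ (hgI' θ hθ),
      sqNorm_comp_neg] at s2
    have hχ' : Cut univ (deriv χ) := hχ.deriv
    have hbe : Cut T fun t => b t * Real.exp t := hb.mul contDiff_ofReal_exp
    have hsupp : ∀ x : R3, x 2 ∈ tsupport (deriv χ) → x 2 ∈ tsupport χ := fun x h =>
      tsupport_deriv_subset h
    have bP := bump_cc 1 v
    have bM := bump_cc (-1) v
    have b2 := bump_comp v 2
    have a1 := norm_integral_wpol_mul_le_of_support hI hIπ hT hχ' hbe hψπ (bM.pd 2).memLp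
      fun x h1 h2 h3 => hv _ 2 x (hsupp x h1) h2 h3
    have a2 := norm_integral_wpol_mul_le_of_support hI hIπ hT hχ' hbe hψrπ (bP.pd 2).memLp
      fun x h1 h2 h3 => hv _ 2 x (hsupp x h1) h2 h3
    have a3 := norm_integral_wpol_mul_le_of_support hI hIπ hT hχ' hbe hψπ (b2.dz 1).memLp
      fun x h1 h2 h3 => hv2 1 x (hsupp x h1) h2 h3
    have a4 := norm_integral_wpol_mul_le_of_support hI hIπ hT hχ' hbe hψrπ (b2.dz (-1)).memLp
      fun x h1 h2 h3 => hv2 (-1) x (hsupp x h1) h2 h3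
    have hs' : 2 * (σ : ℂ) - 1 = (s : ℝ) := by rw [hs]; push_cast; ring
    have form := L_apply_complex (σ : ℂ) u v u2
    rw [hp, hmm, pd_pol_axial_eq_wpol hT hχ hb hψπ, pd_pol_axial_eq_wpol hT hχ hb hψrπ, hs'] at form
    rw [form]
    set V := ‖(v : H10 Ω)‖
    have hV : 0 ≤ V := norm_nonneg _
    have q1 : √(∫ x, ‖dz 1 (cc 1 v) x‖ ^ 2) ≤ 2 * V := sqrt_integral_dz_cc_le (by simp) (by simp) v
    have q2 : √(∫ x, ‖dz (-1) (cc 1 v) x‖ ^ 2) ≤ 2 * V := sqrt_integral_dz_cc_le (by simp) (by simp) v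
    have q3 : √(∫ x, ‖dz 1 (cc (-1) v) x‖ ^ 2) ≤ 2 * V := sqrt_integral_dz_cc_le (by simp) (by simp) v
    have q4 : √(∫ x, ‖dz (-1) (cc (-1) v) x‖ ^ 2) ≤ 2 * V :=
      sqrt_integral_dz_cc_le (by simp) (by simp) v
    have q5 : √(∫ x, ‖pd 2 (cc (-1) v) x‖ ^ 2) ≤ 2 * V := sqrt_integral_pd_cc_le (by simp) v 2
    have q6 : √(∫ x, ‖pd 2 (cc 1 v) x‖ ^ 2) ≤ 2 * V := sqrt_integral_pd_cc_le (by simp) v 2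
    have q7 : √(∫ x, ‖dz 1 (comp v 2) x‖ ^ 2) ≤ 2 * V := sqrt_integral_dz_comp_le (by simp) v
    have q8 : √(∫ x, ‖dz (-1) (comp v 2) x‖ ^ 2) ≤ 2 * V := sqrt_integral_dz_comp_le (by simp) v
    set Δ := √(X * sqNorm univ b * sqNorm I (angDefect s ξ κ ψ))
    have hΔ : 0 ≤ Δ := Real.sqrt_nonneg _
    replace s1 := s1.trans (add_le_add (mul_le_mul_of_nonneg_left q4 (by positivity))
      (mul_le_mul_of_nonneg_left q3 (by positivity)))
    replace s2 := s2.trans (add_le_add (mul_le_mul_of_nonneg_left q1 (by positivity))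
      (mul_le_mul_of_nonneg_left q2 (by positivity)))
    replace a1 := a1.trans (mul_le_mul_of_nonneg_left q5 (by positivity))
    replace a2 := a2.trans (mul_le_mul_of_nonneg_left q6 (by positivity))
    replace a3 := a3.trans (mul_le_mul_of_nonneg_left q7 (by positivity))
    replace a4 := a4.trans (mul_le_mul_of_nonneg_left q8 (by positivity))
    rw [sqrt_mul_three_right hX0 (sqNorm_nonneg _ _), sqrt_mul_three_right hX0 (sqNorm_nonneg _ _)]
      at s1 s2
    rw [sqrt_mul_three_right hX0' (sqNorm_nonneg _ _)] at a1 a2 a3 a4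
    have a5 : ‖(σ : ℂ) / 2 *
        ((∫ x, wpol (deriv χ) (fun t => b t * Real.exp t) ψ x * pd 2 (cc (-1) v) x)
          + ∫ x, wpol (deriv χ) (fun t => b t * Real.exp t) (fun θ => κ * ψ (-θ)) x * pd 2 (cc 1 v) x)‖
        ≤ |σ| / 2 * (√(X' * n) * √β * (2 * V) + √(X' * n') * √β * (2 * V)) := by
      rw [norm_mul, norm_div, Complex.norm_real, Complex.norm_two, Real.norm_eq_abs]
      exact mul_le_mul_of_nonneg_left ((norm_add_le _ _).trans (add_le_add a1 a2)) (by positivity)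
    refine (norm_add_le _ _).trans ((add_le_add ((norm_sub_le _ _).trans (add_le_add
      ((norm_add_le _ _).trans (add_le_add s1 s2)) a5)) ((norm_add_le _ _).trans (add_le_add a3 a4))).trans ?_)
    · have r1 : 0 ≤ C₂ * √α * V := by positivity
      have r2 : 0 ≤ C₁ * √β * V := by positivity
      have r3 : 0 ≤ 2 * (X * m) * (√α + √β) * V := by positivity
      have r4 : (4 * Δ + (C₁ + C₂ + 2 * (X * m)) * (√α + √β)) * V =
          4 * Δ * V + C₁ * √α * V + C₂ * √β * V + (C₂ * √α * V + C₁ * √β * V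
            + 2 * (X * m) * (√α + √β) * V) := by ring
      rw [r4]
      have r5 : 4 * Δ * V + C₁ * √α * V + C₂ * √β * V ≤ 4 * Δ * V + C₁ * √α * V + C₂ * √β * V
        + (C₂ * √α * V + C₁ * √β * V + 2 * (X * m) * (√α + √β) * V) := by linarith
      refine le_trans (le_of_eq ?_) r5
      rw [hC₁, hC₂]
      ring

end Estimate

end Cosserat

/-! ### Radial factors and quasimodes -/

namespace Cosserat

open scoped ContDiff
open Set Filter

theorem integral_dilate {N : ℝ} (hN : 0 < N) (f : ℝ → ℝ) :
    ∫ t, f (t / N + 2) = N * ∫ t, f t := by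
  have h := Measure.integral_comp_div (fun t => f (t + 2)) N
  rw [h, abs_of_pos hN, smul_eq_mul, integral_add_right_eq_self f 2]

theorem exists_bump_sqNorm {ρ : ℝ} (hρ : 0 < ρ) :
    ∃ g : ℝ → ℂ, Cut univ g ∧ tsupport g ⊆ Icc (-ρ) ρ ∧ 0 < sqNorm univ g := by
  let η : ContDiffBump (0 : ℝ) := ⟨ρ / 2, ρ, by linarith, by linarith⟩
  have hc : ContDiff ℝ ∞ fun θ => ((η θ : ℝ) : ℂ) := Complex.ofRealCLM.contDiff.comp η.contDiff
  have hs : HasCompactSupport fun θ => ((η θ : ℝ) : ℂ) :=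
    η.hasCompactSupport.comp_left (g := fun r : ℝ => (r : ℂ)) Complex.ofReal_zero
  refine ⟨fun θ => ((η θ : ℝ) : ℂ), ⟨hc, hs, subset_univ _⟩, ?_, ?_⟩
  · have : tsupport (fun θ : ℝ => ((η θ : ℝ) : ℂ)) ⊆ tsupport η :=
      closure_mono fun θ hθ h0 => hθ (by simp [h0])
    refine this.trans ?_
    rw [η.tsupport_eq, Real.closedBall_eq_Icc, zero_sub, zero_add]
  · have h1 := sqNorm_pos (w := ρ) hc.continuous (θ := 0) ⟨by linarith, hρ⟩ (by
      rw [η.one_of_mem_closedBall (Metric.mem_closedBall_self η.rIn_pos.le)]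
      simp)
    refine h1.trans_le (setIntegral_mono_set ?_ (Eventually.of_forall fun t => by positivity)
      (Eventually.of_forall (subset_univ _)))
    exact ((hc.continuous.memLp_of_hasCompactSupport hs (p := 2)).integrable_norm_pow
      (by simp)).integrableOn

theorem norm_cexp_mul_I (ξ t : ℝ) : ‖Complex.exp (Complex.I * ξ * t)‖ = 1 := by
  rw [show Complex.I * (ξ : ℂ) * t = ((ξ * t : ℝ) : ℂ) * Complex.I by push_cast; ring]
  exact Complex.norm_exp_ofReal_mul_I _

/-- Slowly varying radial factors, in logarithmic scale. -/
theorem exists_radial (ξ : ℝ) : ∃ c : ℝ, 0 < c ∧ ∀ δ > 0, ∃ N₀ : ℝ, 0 < N₀ ∧ ∀ N ≥ N₀,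
    ∃ a b : ℝ → ℂ, Cut (Icc (-(3 * N)) (-N)) a ∧ Cut (Icc (-(3 * N)) (-N)) b ∧
      (∀ t, deriv b t = a t + Complex.I * ξ * b t) ∧ sqNorm univ b = c ∧ sqNorm univ a ≤ δ ∧
      (sqNorm univ fun t => b t * Real.exp t) ≤ δ := by
  obtain ⟨g, hg, hgs, hgp⟩ := exists_bump_sqNorm (ρ := 1) one_pos
  set c := sqNorm univ g with hc
  set c' := sqNorm univ (deriv g) with hc'
  have hc0' : 0 ≤ c' := sqNorm_nonneg _ _
  refine ⟨c, hgp, fun δ hδ => ⟨(c + c') / δ + 1, by positivity, fun N hN => ?_⟩⟩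
  have hN1 : 1 ≤ N := le_trans (by have : 0 ≤ (c + c') / δ := by positivity
                                   linarith) hN
  have hN0 : 0 < N := by linarith
  have hcN : (c + c') / N ≤ δ := by
    rw [div_le_iff₀ hN0, mul_comm, ← div_le_iff₀ hδ]
    linarith
  -- Normalizes the L² norm of `b` independently of `N`. Then ‖a‖² is of order N⁻², and the factor
  -- e^t ≤ e^{-N} on the support is more than enough.
  set r : ℂ := Complex.ofReal (√N)⁻¹ with hr
  have hr2 : ‖r‖ ^ 2 = N⁻¹ := by
    rw [hr, Complex.norm_real, Real.norm_eq_abs, sq_abs, inv_pow, Real.sq_sqrt hN0.le]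
  set b : ℝ → ℂ := fun t => r * g (t / N + 2) * Complex.exp (Complex.I * ξ * t) with hb
  have hsm : ContDiff ℝ ∞ b := (contDiff_const.mul (hg.smooth.comp
    ((contDiff_id.div_const N).add contDiff_const))).mul (contDiff_cexp_mul _)
  have hT : ∀ t, t / N + 2 ∈ Icc (-1 : ℝ) 1 → t ∈ Icc (-(3 * N)) (-N) := fun t ht => by
    have h1 : t = (t / N) * N := by field_simp
    constructor <;> rw [h1] <;> nlinarith [ht.1, ht.2]
  have hsup : Function.support b ⊆ Icc (-(3 * N)) (-N) := fun t ht => by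
    refine hT t (hgs (subset_tsupport _ fun h0 => ht ?_))
    simp [hb, h0]
  have cb : Cut (Icc (-(3 * N)) (-N)) b :=
    ⟨hsm, HasCompactSupport.of_support_subset_isCompact isCompact_Icc hsup,
      closure_minimal hsup isClosed_Icc⟩
  have hbn : ∀ t, ‖b t‖ ^ 2 = N⁻¹ * ‖g (t / N + 2)‖ ^ 2 := fun t => by
    rw [hb]
    simp only [norm_mul, norm_cexp_mul_I, mul_one, mul_pow, hr2]
  have hsb : sqNorm univ b = c := by
    rw [sqNorm, hc, sqNorm, setIntegral_univ, setIntegral_univ]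
    simp only [hbn]
    rw [integral_const_mul, integral_dilate hN0 fun t => ‖g t‖ ^ 2]
    field_simp
  have hd : ∀ t, deriv b t - Complex.I * ξ * b t =
      r * (N⁻¹ : ℝ) * deriv g (t / N + 2) * Complex.exp (Complex.I * ξ * t) := fun t => by
    have h1 : HasDerivAt (fun t : ℝ => t / N + 2) N⁻¹ t := by
      simpa [div_eq_mul_inv] using ((hasDerivAt_id t).div_const N).add_const 2
    have h2 := (hg.smooth.differentiable (by simp) (t / N + 2)).hasDerivAt.scomp t h1
    have h3 := (h2.const_mul r).mul (hasDerivAt_cexp_mul (Complex.I * ξ) t)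
    have h4 : deriv b t = _ := h3.deriv
    rw [h4, hb]
    simp
    ring
  refine ⟨fun t => deriv b t - Complex.I * ξ * b t, b, cb.deriv.sub (cb.const_mul _), cb,
    fun t => by ring, hsb, ?_, ?_⟩
  · refine le_trans ?_ hcN
    rw [sqNorm, setIntegral_univ]
    have h1 : ∀ t, ‖deriv b t - Complex.I * ξ * b t‖ ^ 2 =
        N⁻¹ * (N⁻¹) ^ 2 * ‖deriv g (t / N + 2)‖ ^ 2 := fun t => by
      rw [hd]
      simp only [norm_mul, norm_cexp_mul_I, mul_one, mul_pow, hr2, Complex.norm_real, Real.norm_eq_abs,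
        sq_abs]
    simp only [h1]
    rw [integral_const_mul, integral_dilate hN0 fun t => ‖deriv g t‖ ^ 2]
    have h2 : c' = ∫ t, ‖deriv g t‖ ^ 2 := by rw [hc', sqNorm, setIntegral_univ]
    rw [← h2, show N⁻¹ * N⁻¹ ^ 2 * (N * c') = c' / N / N by field_simp]
    refine (div_le_self (by positivity) hN1).trans ?_
    gcongr
    linarith
  · refine le_trans ?_ hcN
    have h1 : (sqNorm univ fun t => b t * Real.exp t) ≤ ∫ t, ‖b t‖ ^ 2 / N := by
      rw [sqNorm, setIntegral_univ]
      refine integral_mono_of_nonneg (Eventually.of_forall fun t => by positivity)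
        (((hsm.continuous.memLp_of_hasCompactSupport cb.compact (p := 2)).integrable_norm_pow
          (by simp)).div_const N) (Eventually.of_forall fun t => ?_)
      change ‖b t * Real.exp t‖ ^ 2 ≤ ‖b t‖ ^ 2 / N
      by_cases ht : t ∈ Icc (-(3 * N)) (-N)
      · rw [norm_mul, mul_pow, Complex.norm_real, Real.norm_eq_abs, sq_abs, div_eq_mul_inv]
        refine mul_le_mul_of_nonneg_left ?_ (by positivity)
        have h2 : Real.exp t ≤ N⁻¹ := by
          calc Real.exp t ≤ Real.exp (-N) := Real.exp_le_exp.2 ht.2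
            _ = (Real.exp N)⁻¹ := Real.exp_neg N
            _ ≤ N⁻¹ := by
              gcongr
              linarith [Real.add_one_le_exp N]
        have h3 : N⁻¹ ≤ 1 := inv_le_one_of_one_le₀ hN1
        nlinarith [Real.exp_pos t]
      · simp [cb.eq_zero ht]
    refine h1.trans ?_
    rw [integral_div]
    have h2 : ∫ t, ‖b t‖ ^ 2 = c := by rw [← hsb, sqNorm, setIntegral_univ]
    rw [h2]
    gcongr
    linarith

/-- Approximate null fields of the Cosserat operator concentrated in thin cylindrical shells. -/
def HasQuasimodes (Ω : Opens R3) (σ : ℂ) : Prop :=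
  ∀ ε > 0, ∃ N₀ : ℝ, 0 < N₀ ∧ ∀ N ≥ N₀, ∃ u : TestField Ω,
    (∀ x k j, Real.log ‖planar x‖ ∉ Icc (-(3 * N)) (-N) → pd j (comp u k) x = 0) ∧
    0 < ‖(u : H10 Ω)‖ ∧ ∀ v : TestField Ω, ‖L Ω σ u v‖ ≤ ε * ‖(u : H10 Ω)‖ * ‖(v : H10 Ω)‖

/-- The axial and angular factors are fixed first, which fixes the constant C; only then is N sent
to infinity. -/
theorem hasQuasimodes {Ω : Opens R3} {w ξ s κ R σ : ℝ} (hw : 0 < w) (hw' : w < Real.pi)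
    (hR : 0 < R) (hΩ : (Ω : Set R3) ∩ cylinder (2 * R) = cylinder (2 * R) ∩ wedge (2 * w))
    (hκ : κ * κ = 1) (hs : s = 2 * σ - 1) (hξ : 0 < ξ)
    (hchar : s * Real.sinh (2 * w * ξ) = -κ * ξ * Real.sin (2 * w)) :
    HasQuasimodes Ω σ := by
  intro ε hε
  obtain ⟨χ, hχ, hχR, hX⟩ := exists_bump_sqNorm hR
  obtain ⟨ψ, hψ, hK, hD⟩ := exists_angular hw hξ hκ hchar (ε := (ε / 64) ^ 2) (by positivity)
  obtain ⟨C, hC, hest⟩ := exists_field_estimate (Ω := Ω) (ξ := ξ) hw hw' hR hΩ hκ hs hχ hχR hψ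
  obtain ⟨c, hc, hrad⟩ := exists_radial ξ
  set X := sqNorm univ χ
  set K := sqNorm (Ioo (-w) w) (angGrad ξ ψ)
  set D := sqNorm (Ioo (-w) w) (angDefect s ξ κ ψ)
  set P := X * c * K with hP
  have hP0 : 0 < P := by positivity
  -- The first bound gives ‖u‖ ≥ √P/8. The second keeps the radial and axial errors below ε√P/16,
  -- and the angular tolerance (ε/64)² does the same for four times the defect; together at most
  -- ε‖u‖.
  set δ := min (P / (2 * (C + 1))) ((ε * √P / (32 * (C + 1))) ^ 2) with hδ
  have hδ0 : 0 < δ := by positivity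
  obtain ⟨N₀, hN₀, hrad⟩ := hrad δ hδ0
  -- N ≥ -log(2R) puts the shell r ≤ e^{-N} inside the cylinder.
  refine ⟨max N₀ (-Real.log (2 * R)), lt_max_of_lt_left hN₀, fun N hN => ?_⟩
  obtain ⟨a, b, ha, hb, hd, hbc, haδ, hbδ⟩ := hrad N ((le_max_left _ _).trans hN)
  have hN0 : 0 < N := hN₀.trans_le ((le_max_left _ _).trans hN)
  have hNR := (le_max_right _ _).trans hN
  obtain ⟨u, hu1, hu2, hu3⟩ := hest (Icc (-(3 * N)) (-N)) a b
    (fun t ht => by have := ht.2; rw [mem_Iio]; linarith)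
    (fun t ht => by have := ht.2; rw [mem_Iic]; linarith) ha hb hd
  rw [hbc] at hu2 hu3
  have e1 : C * sqNorm univ a ≤ P / 2 := by
    calc C * sqNorm univ a ≤ (C + 1) * (P / (2 * (C + 1))) :=
          mul_le_mul (by linarith) (haδ.trans (min_le_left _ _)) (sqNorm_nonneg _ _) (by positivity)
      _ = P / 2 := by field_simp
  have e2 : (√P / 8) ^ 2 ≤ ‖(u : H10 Ω)‖ ^ 2 := by
    rw [div_pow, Real.sq_sqrt hP0.le]
    linarith
  have e3 : √P / 8 ≤ ‖(u : H10 Ω)‖ := le_of_sq_le_sq e2 (norm_nonneg _)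
  have hsP : 0 < √P := Real.sqrt_pos.2 hP0
  have e4 : ∀ y, y ≤ δ → √y ≤ ε * √P / (32 * (C + 1)) := fun y hy => by
    refine (Real.sqrt_le_sqrt (hy.trans (min_le_right _ _))).trans ?_
    rw [Real.sqrt_sq (by positivity)]
  have e5 : √(X * c * D) ≤ ε / 64 * √P := by
    have : X * c * D ≤ (ε / 64) ^ 2 * P := by
      calc X * c * D ≤ X * c * ((ε / 64) ^ 2 * K) := by gcongr
        _ = _ := by rw [hP]; ring
    refine (Real.sqrt_le_sqrt this).trans ?_
    rw [Real.sqrt_mul (by positivity), Real.sqrt_sq (by positivity)]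
  refine ⟨u, hu1, lt_of_lt_of_le (by positivity) e3, fun v => (hu3 v).trans ?_⟩
  refine mul_le_mul_of_nonneg_right ?_ (norm_nonneg _)
  have e6 : C * (√(sqNorm univ a) + √(sqNorm univ fun t => b t * Real.exp t)) ≤ ε * √P / 16 := by
    calc _ ≤ (C + 1) * (ε * √P / (32 * (C + 1)) + ε * √P / (32 * (C + 1))) := by
          refine mul_le_mul (by linarith) (add_le_add (e4 _ haδ) (e4 _ hbδ)) (by positivity)
            (by positivity)
      _ = ε * √P / 16 := by field_simp; norm_num
  nlinarith [mul_le_mul_of_nonneg_left e3 hε.le]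

theorem L_sub_apply (Ω : Opens R3) (σ τ : ℂ) (u v : H10 Ω) :
    L Ω σ u v = L Ω τ u v - (σ - τ) * ((L Ω 0 - L Ω 1) u v) := by
  simp only [sub_apply, L_apply]
  ring

/-- `L Ω σ` is affine in σ with a bounded slope, so quasimodes for a nearby τ serve for σ. -/
theorem HasQuasimodes.of_approx {Ω : Opens R3} {σ : ℂ}
    (h : ∀ ε > 0, ∃ τ, ‖σ - τ‖ ≤ ε ∧ HasQuasimodes Ω τ) : HasQuasimodes Ω σ := by
  intro ε hε
  set A := ‖L Ω 0 - L Ω 1‖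
  have hA : 0 < A + 1 := by positivity
  obtain ⟨τ, h1, h2⟩ := h (ε / (2 * (A + 1))) (by positivity)
  obtain ⟨N₀, hN₀, h2⟩ := h2 (ε / 2) (by positivity)
  refine ⟨N₀, hN₀, fun N hN => ?_⟩
  obtain ⟨u, hu1, hu2, hu3⟩ := h2 N hN
  refine ⟨u, hu1, hu2, fun v => ?_⟩
  rw [L_sub_apply Ω σ τ]
  refine (norm_sub_le _ _).trans ?_
  rw [norm_mul]
  have e1 := (L Ω 0 - L Ω 1).le_opNorm₂ (u : H10 Ω) (v : H10 Ω)
  have e2 : ‖σ - τ‖ * ‖(L Ω 0 - L Ω 1) (u : H10 Ω) (v : H10 Ω)‖ ≤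
      (ε / (2 * (A + 1))) * ((A + 1) * ‖(u : H10 Ω)‖ * ‖(v : H10 Ω)‖) := by
    refine mul_le_mul h1 (e1.trans ?_) (norm_nonneg _) (by positivity)
    gcongr
    linarith
  have e3 : (ε / (2 * (A + 1))) * ((A + 1) * ‖(u : H10 Ω)‖ * ‖(v : H10 Ω)‖) =
      ε / 2 * ‖(u : H10 Ω)‖ * ‖(v : H10 Ω)‖ := by
    field_simp
  linarith [hu3 v]

theorem pd_comp_smul {Ω : Opens R3} (c : ℂ) (u : TestField Ω) (k j : Fin 3) (x : R3) :
    pd j (comp (c • u) k) x = c * pd j (comp u k) x :=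
  (bump_comp u k).pd_const_mul c j x

/-- Normalized quasimodes in pairwise disjoint shells form the separated sequence of the Fredholm
criterion. -/
theorem HasQuasimodes.mem_essentialSpectrum {Ω : Opens R3} {σ : ℂ} (h : HasQuasimodes Ω σ) :
    σ ∈ essentialSpectrum Ω := by
  refine not_isFredholm_of_separated _ fun ε hε => ?_
  obtain ⟨N₀, hN₀, h⟩ := h ε hε
  have hN : ∀ k : ℕ, N₀ ≤ 4 ^ k * N₀ := fun k =>
    le_mul_of_one_le_left hN₀.le (one_le_pow₀ (by norm_num))
  -- The ratio 4 exceeds the ratio 3 of the ends of [-3N, -N], so the shells are disjoint.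
  choose u hu1 hu2 hu3 using fun k : ℕ => h (4 ^ k * N₀) (hN k)
  have hnorm : ∀ k, ‖(((((‖(u k : H10 Ω)‖⁻¹ : ℝ) : ℂ) • u k : TestField Ω)) : H10 Ω)‖ = 1 :=
    fun k => by
      rw [UniformSpace.Completion.coe_smul, norm_smul, Complex.norm_real, norm_inv, norm_norm,
        inv_mul_cancel₀ (hu2 k).ne']
  refine ⟨fun k => ((((‖(u k : H10 Ω)‖⁻¹ : ℝ) : ℂ) • u k : TestField Ω) : H10 Ω), hnorm,
    fun k l hkl => ?_, fun k => ?_⟩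
  · rw [← hnorm k]
    refine norm_le_norm_sub _ _ fun x i j m n => ?_
    rw [pd_comp_smul, pd_comp_smul]
    by_cases hx : Real.log ‖planar x‖ ∈ Icc (-(3 * (4 ^ k * N₀))) (-(4 ^ k * N₀))
    · right
      rw [hu1 l x, mul_zero]
      intro hx'
      have h1 : (4 : ℝ) ^ (k + 1) ≤ 4 ^ l := pow_le_pow_right₀ (by norm_num) hkl
      rw [pow_succ] at h1
      have h2 : (4 : ℝ) ^ k * N₀ > 0 := by positivity
      nlinarith [hx.1, hx'.2, mul_le_mul_of_nonneg_right h1 hN₀.le]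
    · left
      rw [hu1 k x i j hx, mul_zero]
  · refine ContinuousLinearMap.opNorm_le_bound _ hε.le fun v => ?_
    induction v using UniformSpace.Completion.induction_on with
    | hp => exact isClosed_le (by fun_prop) (by fun_prop)
    | ih v =>
      beta_reduce
      rw [UniformSpace.Completion.coe_smul, map_smul, smul_apply, norm_smul,
        Complex.norm_real, norm_inv, norm_norm, inv_mul_le_iff₀ (hu2 k)]
      linarith [hu3 k v]

/-! ### The characteristic equation and the conclusion -/

/-- Solvability of the characteristic equation. -/
theorem exists_characteristic {q s A : ℝ} (hq : 0 < q) (hs : 0 < s) (hsA : s * q < A) :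
    ∃ ξ, 0 < ξ ∧ s * Real.sinh (q * ξ) = ξ * A := by
  have hA : 0 < A := lt_trans (by positivity) hsA
  set f : ℝ → ℝ := fun ξ => ξ * A - s * Real.sinh (q * ξ) with hf
  have hcont : Continuous f := by
    have := Real.continuous_sinh
    fun_prop
  have hd : HasDerivAt f (A - s * q) 0 := by
    have h1 : HasDerivAt (fun ξ : ℝ => q * ξ) q 0 := by
      simpa using (hasDerivAt_id (0 : ℝ)).const_mul q
    have h2 := (Real.hasDerivAt_sinh (q * 0)).comp (0 : ℝ) h1
    have h3 := ((hasDerivAt_id (0 : ℝ)).mul_const A).sub (h2.const_mul s)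
    refine (h3.congr_deriv (by simp)).congr_of_eventuallyEq (Eventually.of_forall fun y => ?_)
    simp [hf]
  have hev := (hasDerivAt_iff_tendsto_slope_zero.1 hd).mono_left
    (nhdsWithin_mono _ (fun x (hx : x ∈ Ioi (0 : ℝ)) => ne_of_gt hx))
  obtain ⟨x, hx, hx0⟩ := ((hev.eventually (lt_mem_nhds (show 0 < A - s * q by linarith))).and
    self_mem_nhdsWithin).exists
  have hx0' : 0 < x := hx0
  have hfx : 0 < f x := by
    have hf0 : f 0 = 0 := by simp [hf]
    rw [zero_add, hf0, sub_zero, smul_eq_mul] at hx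
    exact (mul_pos_iff_of_pos_left (inv_pos.2 hx0')).1 hx
  -- The point where the lower bound s (qy)²/4 of s sinh(qy) equals yA. Near 0 the slope A - sq > 0
  -- makes f positive, so f has a zero in (0, ∞).
  set y := 4 * A / (s * q ^ 2) with hy
  have hy0 : 0 < y := by positivity
  have hfy : f y ≤ 0 := by
    have h1 := Real.quadratic_le_exp_of_nonneg (show 0 ≤ q * y by positivity)
    have h2 : Real.exp (-(q * y)) ≤ 1 := Real.exp_le_one_iff.2 (by nlinarith)
    have h3 : (q * y) ^ 2 / 4 ≤ Real.sinh (q * y) := by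
      rw [Real.sinh_eq]
      have : 0 ≤ q * y := by positivity
      linarith
    have h4 : s * ((q * y) ^ 2 / 4) = y * A := by
      rw [hy]; field_simp
    have h5 := mul_le_mul_of_nonneg_left h3 hs.le
    simp only [hf]
    linarith
  obtain ⟨ξ, hξ, hfξ⟩ := isPreconnected_Ioi.intermediate_value (s := Ioi (0 : ℝ)) hy0 hx0
    hcont.continuousOn ⟨hfy, hfx.le⟩
  refine ⟨ξ, hξ, ?_⟩
  simp only [hf] at hfξ
  linarith

/-- Approximation of `s ∈ [-A, A]` by nonzero numbers of absolute value less than `A`. -/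
theorem exists_near {A s ε : ℝ} (hA : 0 < A) (hs : |s| ≤ A) (hε : 0 < ε) :
    ∃ s', 0 < |s'| ∧ |s'| < A ∧ |s - s'| ≤ ε := by
  obtain ⟨h1, h2⟩ := abs_le.1 hs
  rcases lt_trichotomy s 0 with h | h | h
  · have m1 : 0 < min ε (-s / 2) := lt_min hε (by linarith)
    have m2 := min_le_left ε (-s / 2)
    have m3 := min_le_right ε (-s / 2)
    refine ⟨s + min ε (-s / 2), ?_, ?_, ?_⟩
    · exact abs_pos.2 (by linarith)
    · rw [abs_lt]; constructor <;> linarith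
    · rw [abs_le]; constructor <;> linarith
  · have m1 : 0 < min ε (A / 2) := lt_min hε (by linarith)
    have m2 := min_le_left ε (A / 2)
    have m3 := min_le_right ε (A / 2)
    refine ⟨min ε (A / 2), abs_pos.2 m1.ne', ?_, ?_⟩
    · rw [abs_lt]; constructor <;> linarith
    · rw [abs_le]; constructor <;> linarith
  · have m1 : 0 < min ε (s / 2) := lt_min hε (by linarith)
    have m2 := min_le_left ε (s / 2)
    have m3 := min_le_right ε (s / 2)
    refine ⟨s - min ε (s / 2), ?_, ?_, ?_⟩
    · exact abs_pos.2 (by linarith)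
    · rw [abs_lt]; constructor <;> linarith
    · rw [abs_le]; constructor <;> linarith

theorem hasQuasimodes_of_mem_Icc {Ω : Opens R3} {w : ℝ} (hw : 0 < w) (hw' : w < Real.pi)
    (hΩ : HasStraightEdge Ω (2 * w)) {σ : ℝ}
    (hσ : |2 * σ - 1| ≤ |Real.sin (2 * w)| / (2 * w)) : HasQuasimodes Ω σ := by
  obtain ⟨R, hR, hΩ⟩ := hΩ
  by_cases h0 : Real.sin (2 * w) = 0
  · have h1 : 2 * σ - 1 = 0 := by
      rw [h0, abs_zero, zero_div] at hσ
      exact abs_nonpos_iff.1 hσ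
    refine hasQuasimodes (ξ := 1) (κ := 1) hw hw' hR hΩ (by norm_num) rfl one_pos ?_
    rw [h1, h0]
    simp
  · have hA : 0 < |Real.sin (2 * w)| / (2 * w) := by positivity
    refine HasQuasimodes.of_approx fun ε hε => ?_
    obtain ⟨s, hs0, hsA, hsε⟩ := exists_near hA hσ (show 0 < 2 * ε by linarith)
    rw [lt_div_iff₀ (by positivity)] at hsA
    obtain ⟨ξ, hξ, hch⟩ := exists_characteristic (show 0 < 2 * w by linarith) hs0 hsA
    refine ⟨((1 + s) / 2 : ℝ), ?_, ?_⟩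
    · rw [← Complex.ofReal_sub, Complex.norm_real, Real.norm_eq_abs]
      rw [abs_le] at hsε ⊢
      constructor <;> linarith [hsε.1, hsε.2]
    · have hs : s = 2 * ((1 + s) / 2) - 1 := by ring
      -- κ is minus the sign of s sin(2w), so that s and -κ sin(2w) have the same sign.
      rcases lt_or_gt_of_ne (abs_pos.1 hs0) with hs1 | hs1 <;>
        rcases lt_or_gt_of_ne h0 with h1 | h1
      · rw [abs_of_neg hs1, abs_of_neg h1] at hch
        exact hasQuasimodes (κ := -1) hw hw' hR hΩ (by norm_num) hs hξ (by linarith)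
      · rw [abs_of_neg hs1, abs_of_pos h1] at hch
        exact hasQuasimodes (κ := 1) hw hw' hR hΩ (by norm_num) hs hξ (by linarith)
      · rw [abs_of_pos hs1, abs_of_neg h1] at hch
        exact hasQuasimodes (κ := 1) hw hw' hR hΩ (by norm_num) hs hξ (by linarith)
      · rw [abs_of_pos hs1, abs_of_pos h1] at hch
        exact hasQuasimodes (κ := -1) hw hw' hR hΩ (by norm_num) hs hξ (by linarith)

end Cosserat

theorem theorem4p1 (Ω : TopologicalSpace.Opens Cosserat.R3) (ω : ℝ) (hω : ω ∈ Set.Ioo 0 (2 * Real.pi))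
    (hΩ : Cosserat.HasStraightEdge Ω ω) :
    ∀ σ ∈ Set.Icc (1 / 2 - |Real.sin ω| / (2 * ω)) (1 / 2 + |Real.sin ω| / (2 * ω)),
      (σ : ℂ) ∈ Cosserat.essentialSpectrum Ω := by
  intro σ hσ
  have e : 2 * (ω / 2) = ω := by ring
  refine (Cosserat.hasQuasimodes_of_mem_Icc (w := ω / 2) (by linarith [hω.1]) (by linarith [hω.2])
    (by rwa [e]) ?_).mem_essentialSpectrum
  rw [e]
  have h : |Real.sin ω| / ω = 2 * (|Real.sin ω| / (2 * ω)) := by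
    have := hω.1
    field_simp
  rw [h, abs_le]
  constructor <;> linarith [hσ.1, hσ.2]
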